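/- Let $\mathbb C_0=\mathbb C$ be the plane of basepoints, let $\mathrm X=\{(\mathbf a,\mathbf b,\mathbf c)\in\mathbb C^3:\mathbf a+\mathbf b+\mathbf c=0\}$, and let $\rho:\mathbb P^1(\mathbb R)\to\mathbb R/\pi$, $[x,y]\mapsto\mathrm{Arg}(x+y\,i)\bmod\pi$, which is a bijection. Let $\mathfrak T$ (the set of labeled, oriented, possibly degenerate triangles) be the set of all $$\big(B_0;(\mathbf a,\mathbf b,\mathbf c);[a_1,a_2,b_1,b_2,c_1,c_2];(\xi_{\mathbf a},\xi_{\mathbf b},\xi_{\mathbf c})\big)\in\mathbb C_0\times \mathrm X\times\mathbb P^5(\mathbb R)\times(\mathbb R/\pi)^3$$ such that (i) if $(\mathbf a,\mathbf b,\mathbf c)\ne 0$, then $[a_1,a_2,b_1,b_2,c_1,c_2]=[\mathrm{re}\,\mathbf a,\mathrm{im}\,\mathbf a,\mathrm{re}\,\mathbf b,\mathrm{im}\,\mathbf b,\mathrm{re}\,\mathbf c,\mathrm{im}\,\mathbf c]$; (ii) if $(\mathbf a,\mathbf b,\mathbf c)=0$, then $a_1+b_1+c_1=a_2+b_2+c_2=0$;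 (iii) if $a_1+a_2i\ne0$, then $\xi_{\mathbf a}=\mathrm{Arg}(a_1+a_2i)\bmod\pi$, and similarly for $\xi_{\mathbf b},\xi_{\mathbf c}$ (an argument whose pair is zero is arbitrary). For a real algebraic set $Y$ (a Zariski closed subset of the real points of a product of an affine space and projective spaces) and an algebraic subset $Z\subseteq Y$ whose ideal sheaf on $Y$ is generated by multihomogeneous polynomials $F_0,\dots,F_m$ of equal multidegree, the real blowup $\mathrm{Bl}_Z(Y)$ is the Zariski closure in $Y\times\mathbb P^m(\mathbb R)$ of the graph of $[F_0,\dots,F_m]$ on $Y\setminus Z$. Let $\mathrm{Bl}_0(\mathbb C_0\times \mathrm X)\subset\mathbb C_0\times \mathrm X\times\mathbb P^5(\mathbb R)$ be the real blowup of $\mathbb C_0\times \mathrm X$ along $\mathbb C_0\times\{0\}$, formed with the six real coordinate functions of $(\mathbf a,\mathbf b,\mathbf c)$, which generate the ideal of $\mathbb C_0\times\{0\}$. Let $H\subset \mathrm X$ be the set of $(\mathbf a,\mathbf b,\mathbf c)\in \mathrm X$ with $\mathbf a=0$ or $\mathbf b=0$ or $\mathbf c=0$, and let $\widetilde H\subset\mathrm{Bl}_0(\mathbb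 C_0\times \mathrm X)$ be the strict transform of $\mathbb C_0\times H$, i.e. the Zariski closure of the preimage of $\mathbb C_0\times(H\setminus\{0\})$. Then the eight monomials $X_iY_jZ_k$ ($i,j,k\in\{1,2\}$) in the homogeneous coordinates $[X_1,X_2,Y_1,Y_2,Z_1,Z_2]$ of $\mathbb P^5(\mathbb R)$ generate the ideal sheaf of $\widetilde H$ on $\mathrm{Bl}_0(\mathbb C_0\times \mathrm X)$. Let $\mathrm{Bl}_{\widetilde H}(\mathrm{Bl}_0(\mathbb C_0\times \mathrm X))\subset\mathbb C_0\times \mathrm X\times\mathbb P^5(\mathbb R)\times\mathbb P^7(\mathbb R)$ be the real blowup formed with them. With $(\mathbb R/\pi)^3$ identified with $\mathbb P^1(\mathbb R)^3$ through $\rho$, and $\mathbb P^1(\mathbb R)^3$ embedded in $\mathbb P^7(\mathbb R)$ by the Segre embedding, $$\mathrm{Bl}_{\widetilde H}(\mathrm{Bl}_0(\mathbb C_0\times \mathrm X))=\mathfrak T .$$ This is an equality of sets, and the identification is an isomorphism of real varieties. Both $\mathrm{Bl}_{\widetilde H}(\mathrm{Bl}_0(\mathbb C_0\times \mathrm X))$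 and $\mathfrak T$, the latter as a subset of $\mathbb C_0\times\mathbb C^3\times\mathbb P^5(\mathbb R)\times\mathbb P^1(\mathbb R)^3$, are smooth $\mathbb R$-varieties of dimension $6$, i.e. nonsingular real algebraic sets of pure dimension $6$. -/

import Mathlib

open scoped LinearAlgebra.Projectivization

noncomputable section

/-! ### Real algebraic sets in products of an affine space and projective spaces -/

/-- The real points of `𝔸^A × ∏ k, ℙ^(ι k)`: an affine space with coordinates indexed by `A`, times
projective spaces with homogeneous coordinates indexed by `ι k`. -/
abbrev MultiProj (A : Type) {κ : Type} (ι : κ → Type) : Type :=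
  (A → ℝ) × ((k : κ) → ℙ ℝ (ι k → ℝ))

/-- The coordinate ring: one variable for each affine and each homogeneous coordinate. -/
abbrev CoordRing (A : Type) {κ : Type} (ι : κ → Type) : Type :=
  MvPolynomial (A ⊕ (Σ k, ι k)) ℝ

section MultiProjective

variable {A κ : Type} {ι : κ → Type}

/-- The multidegree of a variable: `0` for affine ones, the `k`-th unit vector for those of the
`k`-th projective factor. -/
def multiWeight (A : Type) {κ : Type} (ι : κ → Type) : A ⊕ (Σ k, ι k) → (κ → ℕ) :=
  open Classical in Sum.elim (fun _ => 0) (fun x => Pi.single x.1 1)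

/-- `G` is multihomogeneous of multidegree `d` (with no condition on the affine variables). -/
def IsMultiHom (G : CoordRing A ι) (d : κ → ℕ) : Prop :=
  MvPolynomial.IsWeightedHomogeneous (multiWeight A ι) G d

/-- A vector of affine and homogeneous coordinates of a point. -/
def coordVec (p : MultiProj A ι) : A ⊕ (Σ k, ι k) → ℝ :=
  Sum.elim p.1 (fun x => (p.2 x.1).rep x.2)

/-- The value of a polynomial at the chosen coordinates of a point. For multihomogeneous
polynomials, its vanishing, and the ratio of two values of the same multidegree, do not depend on
the choice. -/
def valAt (G : CoordRing A ι) (p : MultiProj A ι) : ℝ :=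
  MvPolynomial.eval (coordVec p) G

/-- Zariski closure: the common zeros of all multihomogeneous polynomials vanishing on `S`. -/
def zariskiClosure (S : Set (MultiProj A ι)) : Set (MultiProj A ι) :=
  {p | ∀ (d : κ → ℕ) (G : CoordRing A ι), IsMultiHom G d →
    (∀ q ∈ S, valAt G q = 0) → valAt G p = 0}

/-- A Zariski closed set, i.e. a real algebraic set. -/
def IsAlgebraicSet (V : Set (MultiProj A ι)) : Prop :=
  zariskiClosure V = V

/-- The dimension of `𝔸^A × ∏ k, ℙ^(ι k)`. -/
def ambientDim (A : Type) {κ : Type} [Fintype κ] (ι : κ → Type) : ℕ :=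
  Nat.card A + ∑ k, (Nat.card (ι k) - 1)

/-- `V` is a smooth (nonsingular) real variety of pure dimension `n`: it is a real algebraic set,
and at every point of `V` there are `c = (ambient dimension) - n` multihomogeneous polynomials that
vanish on `V`, cut out `V` in a Zariski open neighbourhood `{S ≠ 0}` of the point, and have linearly
independent gradients at the point (the Jacobian criterion in affine and homogeneous
coordinates). -/
def IsSmoothVariety [Fintype κ] (V : Set (MultiProj A ι)) (n : ℕ) : Prop :=
  IsAlgebraicSet V ∧
  ∀ p ∈ V, ∃ (c : ℕ) (f : Fin c → CoordRing A ι) (d : Fin c → κ → ℕ)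
      (S : CoordRing A ι) (e : κ → ℕ),
    c + n = ambientDim A ι ∧
    (∀ j, IsMultiHom (f j) (d j)) ∧ (∀ j, ∀ q ∈ V, valAt (f j) q = 0) ∧
    IsMultiHom S e ∧ valAt S p ≠ 0 ∧
    (∀ q, valAt S q ≠ 0 → (∀ j, valAt (f j) q = 0) → q ∈ V) ∧
    LinearIndependent ℝ (fun j => fun x => valAt (MvPolynomial.pderiv x (f j)) p)

/-- The map `f`, restricted to `V`, is a regular map (morphism of real varieties): near every point
of `V` its affine coordinates are quotients of multihomogeneous polynomials of equal multidegree
with nonvanishing denominator, and its homogeneous coordinates in each projective factor are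
multihomogeneous polynomials of equal multidegree without common zero. -/
def IsRegularMapOn {A' κ' : Type} {ι' : κ' → Type}
    (f : MultiProj A ι → MultiProj A' ι') (V : Set (MultiProj A ι)) : Prop :=
  ∀ p ∈ V, ∃ (S : CoordRing A ι) (e : κ → ℕ) (P : A' → CoordRing A ι)
      (Q : (k : κ') → ι' k → CoordRing A ι) (d : κ' → κ → ℕ),
    IsMultiHom S e ∧ valAt S p ≠ 0 ∧
    (∀ a, IsMultiHom (P a) e) ∧ (∀ k i, IsMultiHom (Q k i) (d k)) ∧
    ∀ q ∈ V, valAt S q ≠ 0 →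
      (∀ a, (f q).1 a = valAt (P a) q / valAt S q) ∧
      (∀ k, ∃ h : (fun i => valAt (Q k i) q) ≠ 0, (f q).2 k = Projectivization.mk ℝ _ h)

/-- `f` restricts to an isomorphism of real varieties from `V` onto `W`. -/
def IsBiregularOn {A' κ' : Type} {ι' : κ' → Type} (f : MultiProj A ι → MultiProj A' ι')
    (V : Set (MultiProj A ι)) (W : Set (MultiProj A' ι')) : Prop :=
  IsRegularMapOn f V ∧ f '' V = W ∧
    ∃ g : MultiProj A' ι' → MultiProj A ι, IsRegularMapOn g W ∧ ∀ p ∈ V, g (f p) = p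

/-! ### Blowups -/

/-- The index family of the projective factors after adjoining one more factor `ℙ^J`. -/
abbrev adjoin {κ : Type} (ι : κ → Type) (J : Type) : Option κ → Type
  | none => J
  | some k => ι k

/-- The point `(p, x)` of `(𝔸^A × ∏ k, ℙ^(ι k)) × ℙ^J`. -/
def adjoinPoint {J : Type} (p : MultiProj A ι) (x : ℙ ℝ (J → ℝ)) : MultiProj A (adjoin ι J) :=
  (p.1, fun o => match o with
    | none => x
    | some k => p.2 k)

/-- The projection forgetting the factor `ℙ^J`. -/
def dropPoint {J : Type} (q : MultiProj A (adjoin ι J)) : MultiProj A ι :=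
  (q.1, fun k => q.2 (some k))

/-- The multihomogeneous polynomials `F j`, all of multidegree `d`, generate the ideal sheaf of
`Z` on the variety `Y ⊇ Z`: they vanish on `Z`, and near every point `p` of `Y` every `G` vanishing
on `Z` is, as a function on `Y`, a combination of the `F j` after multiplication by some `S` with
`S p ≠ 0`; that is, the `F j` generate the ideal of `Z` in every local ring of `Y`. -/
def GeneratesIdealOf {J : Type} [Fintype J] (Y Z : Set (MultiProj A ι))
    (F : J → CoordRing A ι) (d : κ → ℕ) : Prop :=
  (∀ j, IsMultiHom (F j) d) ∧ (∀ j, ∀ q ∈ Z, valAt (F j) q = 0) ∧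
  ∀ p ∈ Y, ∀ (G : CoordRing A ι) (e : κ → ℕ), IsMultiHom G e → (∀ q ∈ Z, valAt G q = 0) →
    ∃ (S : CoordRing A ι) (s : κ → ℕ) (Q : J → CoordRing A ι) (r : κ → ℕ),
      IsMultiHom S s ∧ (∀ j, IsMultiHom (Q j) r) ∧ s + e = r + d ∧ valAt S p ≠ 0 ∧
      ∀ q ∈ Y, valAt S q * valAt G q = ∑ j, valAt (Q j) q * valAt (F j) q

/-- The graph `{(y, [F j y]_j)}` of the rational map `Y ⇢ ℙ^J` with components `F j`, over the
points where not all `F j` vanish. -/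
def ratGraph {J : Type} (Y : Set (MultiProj A ι)) (F : J → CoordRing A ι) :
    Set (MultiProj A (adjoin ι J)) :=
  {q | ∃ p ∈ Y, ∃ h : (fun j => valAt (F j) p) ≠ 0,
    q = adjoinPoint p (Projectivization.mk ℝ _ h)}

/-- `B` is the real blowup of the real algebraic set `Y` along its algebraic subset `Z`, formed with
the generators `F j` of the ideal of `Z`: the Zariski closure, in `Y × ℙ^J`, of the graph of the
rational map `[F j]_j`. -/
def IsBlowup {J : Type} [Fintype J] (Y Z : Set (MultiProj A ι)) (F : J → CoordRing A ι)
    (d : κ → ℕ) (B : Set (MultiProj A (adjoin ι J))) : Prop :=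
  IsAlgebraicSet Y ∧ IsAlgebraicSet Z ∧ Z ⊆ Y ∧ GeneratesIdealOf Y Z F d ∧
    B = zariskiClosure (ratGraph Y F)

/-- The strict transform of `W` in the blowup `B` along `Z`: the Zariski closure of the
preimage of `W \ Z` in `B`. -/
def strictTransform {J : Type} (B : Set (MultiProj A (adjoin ι J))) (Z W : Set (MultiProj A ι)) :
    Set (MultiProj A (adjoin ι J)) :=
  zariskiClosure {q ∈ B | dropPoint q ∈ W \ Z}

end MultiProjective

/-! ### Arguments modulo `π` -/

/-- The complex number `x₀ + x₁ i`. -/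
def toComplex (x : Fin 2 → ℝ) : ℂ := ⟨x 0, x 1⟩

/-- The real and imaginary parts. -/
def reIm (z : ℂ) : Fin 2 → ℝ := ![z.re, z.im]

/-- The argument of a complex number modulo `π`. -/
def argModPi (z : ℂ) : AddCircle Real.pi := ((Complex.arg z : ℝ) : AddCircle Real.pi)

theorem argModPi_eq_iff {z w : ℂ} (hz : z ≠ 0) (hw : w ≠ 0) :
    argModPi z = argModPi w ↔ z.im * w.re = z.re * w.im := by
  have h1 : argModPi z = argModPi w ↔ Real.sin (Complex.arg z - Complex.arg w) = 0 := by
    unfold argModPi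
    rw [← sub_eq_zero, ← AddCircle.coe_sub, AddCircle.coe_eq_zero_iff, Real.sin_eq_zero_iff]
    simp
  have hz' : ‖z‖ ≠ 0 := norm_ne_zero_iff.2 hz
  have hw' : ‖w‖ ≠ 0 := norm_ne_zero_iff.2 hw
  rw [h1, Real.sin_sub, Complex.sin_arg, Complex.cos_arg hz, Complex.sin_arg, Complex.cos_arg hw,
    sub_eq_zero]
  field_simp

theorem toComplex_ne_zero {x : Fin 2 → ℝ} (hx : x ≠ 0) : toComplex x ≠ 0 := by
  intro h
  apply hx
  have h0 := congrArg Complex.re h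
  have h1 := congrArg Complex.im h
  funext i
  fin_cases i
  · exact h0
  · exact h1

/-- The map `ρ : ℙ¹(ℝ) → ℝ/π`, `[x, y] ↦ Arg (x + y i) mod π`. -/
def rhoFun : ℙ ℝ (Fin 2 → ℝ) → AddCircle Real.pi :=
  Projectivization.lift (fun x => argModPi (toComplex x.1)) (by
    intro a b t h
    refine (argModPi_eq_iff (toComplex_ne_zero a.2) (toComplex_ne_zero b.2)).2 ?_
    simp only [h, toComplex, Pi.smul_apply, smul_eq_mul]
    ring)

theorem rhoFun_bijective : Function.Bijective rhoFun := by
  constructor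
  · intro p q
    induction p with | h x hx =>
    induction q with | h y hy =>
    intro h
    have h' : x 1 * y 0 = x 0 * y 1 :=
      (argModPi_eq_iff (toComplex_ne_zero hx) (toComplex_ne_zero hy)).1 h
    rw [Projectivization.mk_eq_mk_iff']
    by_cases hy0 : y 0 = 0
    · have hy1 : y 1 ≠ 0 := by
        intro hy1
        apply hy
        funext i
        fin_cases i
        · exact hy0
        · exact hy1
      refine ⟨x 1 / y 1, ?_⟩
      have hx0 : x 0 = 0 := by
        rw [hy0, mul_zero] at h'
        exact (mul_eq_zero.1 h'.symm).resolve_right hy1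
      funext i
      fin_cases i
      · simp [hx0, hy0]
      · simp [hy1]
    · refine ⟨x 0 / y 0, ?_⟩
      funext i
      fin_cases i
      · simp [hy0]
      · simp only [Fin.mk_one, Pi.smul_apply, smul_eq_mul]
        field_simp
        linarith
  · intro t
    induction t using QuotientAddGroup.induction_on with | H θ =>
    have hne : (![Real.cos θ, Real.sin θ] : Fin 2 → ℝ) ≠ 0 := by
      intro h
      have h0 : Real.cos θ = 0 := congrFun h 0
      have h1 : Real.sin θ = 0 := congrFun h 1
      have := Real.sin_sq_add_cos_sq θ
      rw [h0, h1] at this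
      norm_num at this
    refine ⟨Projectivization.mk ℝ _ hne, ?_⟩
    have hn := toComplex_ne_zero hne
    have hnorm : ‖toComplex ![Real.cos θ, Real.sin θ]‖ = 1 := by
      have : toComplex ![Real.cos θ, Real.sin θ] = Complex.exp (θ * Complex.I) := by
        apply Complex.ext
        · simp [toComplex, Complex.exp_ofReal_mul_I_re]
        · simp [toComplex, Complex.exp_ofReal_mul_I_im]
      rw [this, Complex.norm_exp_ofReal_mul_I]
    change ((Complex.arg (toComplex ![Real.cos θ, Real.sin θ]) : ℝ) : AddCircle Real.pi)
      = ((θ : ℝ) : AddCircle Real.pi)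
    rw [← sub_eq_zero, ← AddCircle.coe_sub, AddCircle.coe_eq_zero_iff]
    have hs : Real.sin (Complex.arg (toComplex ![Real.cos θ, Real.sin θ]) - θ) = 0 := by
      rw [Real.sin_sub, Complex.sin_arg, Complex.cos_arg hn, hnorm]
      simp only [toComplex, Matrix.cons_val_zero, Matrix.cons_val_one, div_one]
      ring
    obtain ⟨n, hn⟩ := Real.sin_eq_zero_iff.1 hs
    exact ⟨n, by simpa using hn⟩

/-- The identification `ρ` of `ℙ¹(ℝ)` with `ℝ/π`. -/
def rho : ℙ ℝ (Fin 2 → ℝ) ≃ AddCircle Real.pi :=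
  Equiv.ofBijective rhoFun rhoFun_bijective

/-! ### Triangles -/

/-- The index set of the homogeneous coordinates `[a₁, a₂, b₁, b₂, c₁, c₂]` of `ℙ⁵(ℝ)`: a side
and one of its two real coordinates. -/
abbrev SideCoord : Type := Fin 3 × Fin 2

/-- The real coordinates of three side-vectors. -/
def sideVec (v : Fin 3 → ℂ) : SideCoord → ℝ := fun x => reIm (v x.1) x.2

/-- The space `ℂ₀ × ℂ³ × ℙ⁵(ℝ) × (ℝ/π)³` of geometric variables. -/
abbrev GeomVar : Type :=
  ℂ × (Fin 3 → ℂ) × ℙ ℝ (SideCoord → ℝ) × (Fin 3 → AddCircle Real.pi)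

/-- The set of labeled, oriented, possibly degenerate triangles
`(B₀; (𝐚, 𝐛, 𝐜); [a₁, a₂, b₁, b₂, c₁, c₂]; (ξ_a, ξ_b, ξ_c))`. -/
def triangles : Set GeomVar :=
  {T | match T with
    | (_, v, P, ξ) =>
      ∑ s, v s = 0 ∧
      (v ≠ 0 → ∃ h : sideVec v ≠ 0, P = Projectivization.mk ℝ (sideVec v) h) ∧
      (v = 0 → ∀ i, ∑ s, P.rep (s, i) = 0) ∧
      (∀ s, toComplex (fun i => P.rep (s, i)) ≠ 0 →
        ξ s = argModPi (toComplex (fun i => P.rep (s, i))))}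

/-! ### The iterated blowup of `ℂ₀ × X` -/

/-- The index set of the real coordinates of `ℂ₀ × ℂ³`: `none` stands for the basepoint, `some s`
for the side `s`, and the second entry for the real or imaginary part. -/
abbrev AffCoord : Type := Option (Fin 3) × Fin 2

/-- `ℂ₀ × ℂ³` as a real affine space. -/
def affEquiv : ℂ × (Fin 3 → ℂ) ≃ (AffCoord → ℝ) where
  toFun z := fun x => reIm (x.1.elim z.1 z.2) x.2
  invFun x := (toComplex fun i => x (none, i), fun s => toComplex fun i => x (some s, i))
  left_inv z := by
    rcases z with ⟨b, v⟩
    simp [toComplex, reIm]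
  right_inv x := by
    funext ⟨o, i⟩
    cases o <;> fin_cases i <;> simp [toComplex, reIm]

/-- No projective factors. -/
abbrev noFactor : Empty → Type := fun _ => Empty

/-- The real affine space `ℂ₀ × ℂ³`. -/
abbrev Space₀ : Type := MultiProj AffCoord noFactor

/-- `ℂ₀ × ℂ³ × ℙ⁵(ℝ)`. -/
abbrev Space₁ : Type := MultiProj AffCoord (adjoin noFactor SideCoord)

/-- `ℂ₀ × ℂ³ × ℙ⁵(ℝ) × ℙ⁷(ℝ)`; the coordinates of `ℙ⁷(ℝ)` are indexed by the choice of one of two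
coordinates for each of the three sides. -/
abbrev Space₂ : Type := MultiProj AffCoord (adjoin (adjoin noFactor SideCoord) (Fin 3 → Fin 2))

/-- The point of `ℂ₀ × ℂ³` with basepoint `b` and side-vectors `v`, as a real point. -/
def affPoint (b : ℂ) (v : Fin 3 → ℂ) : Space₀ := (affEquiv (b, v), fun k => k.elim)

/-- `ℂ₀ × X`, where `X ⊂ ℂ³` is the plane of side-vectors with sum zero. -/
def baseSpace : Set Space₀ := {p | ∃ b v, ∑ s, v s = 0 ∧ p = affPoint b v}

/-- The locus `ℂ₀ × {0}` of the origin of `X`. -/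
def originLocus : Set Space₀ := {p | ∃ b, p = affPoint b 0}

/-- The locus `ℂ₀ × H`, where `H ⊂ X` is the set of side-vectors at least one of which is zero. -/
def doubleLocus : Set Space₀ :=
  {p | ∃ b v, ∑ s, v s = 0 ∧ (∃ s, v s = 0) ∧ p = affPoint b v}

/-- The six real coordinate functions of the side-vectors. -/
def originEqs : SideCoord → CoordRing AffCoord noFactor :=
  fun x => MvPolynomial.X (Sum.inl (some x.1, x.2))

/-- The blowup of `ℂ₀ × X` at the origin of `X`. -/
def blowup₁ : Set Space₁ := zariskiClosure (ratGraph baseSpace originEqs)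

/-- The strict transform of the double point locus. -/
def doubleStrict : Set Space₁ := strictTransform blowup₁ originLocus doubleLocus

/-- The eight monomials `X_i Y_j Z_k` in the homogeneous coordinates of `ℙ⁵(ℝ)`. -/
def doubleEqs : (Fin 3 → Fin 2) → CoordRing AffCoord (adjoin noFactor SideCoord) :=
  fun e => ∏ s, MvPolynomial.X (Sum.inr ⟨none, (s, e s)⟩)

/-- The blowup of `blowup₁` along the strict transform of the double point locus. -/
def blowup₂ : Set Space₂ := zariskiClosure (ratGraph blowup₁ doubleEqs)

/-! ### The space of geometric variables as a real variety -/

/-- `ℂ₀ × ℂ³ × ℙ⁵(ℝ) × ℙ¹(ℝ)³`. -/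
abbrev SpaceT : Type := MultiProj AffCoord (adjoin (fun _ : Fin 3 => Fin 2) SideCoord)

/-- The identification of `ℂ₀ × ℂ³ × ℙ⁵(ℝ) × (ℝ/π)³` with `ℂ₀ × ℂ³ × ℙ⁵(ℝ) × ℙ¹(ℝ)³`, through
real and imaginary parts and through `ρ`. -/
def geomVarEquiv : GeomVar ≃ SpaceT where
  toFun T := (affEquiv (T.1, T.2.1), fun o => match o with
    | none => T.2.2.1
    | some s => rho.symm (T.2.2.2 s))
  invFun q := ((affEquiv.symm q.1).1, (affEquiv.symm q.1).2, q.2 none, fun s => rho (q.2 (some s)))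
  left_inv T := by simp
  right_inv q := by
    refine Prod.ext (by simp) ?_
    funext o
    cases o <;> simp

theorem segre_ne_zero (x : Fin 3 → ℙ ℝ (Fin 2 → ℝ)) :
    (fun e : Fin 3 → Fin 2 => ∏ s, (x s).rep (e s)) ≠ 0 := by
  have h : ∀ s, ∃ i, (x s).rep i ≠ 0 := fun s => Function.ne_iff.1 (x s).rep_nonzero
  choose e he using h
  exact Function.ne_iff.2 ⟨e, Finset.prod_ne_zero_iff.2 fun s _ => he s⟩

/-- The Segre embedding `ℙ¹(ℝ)³ → ℙ⁷(ℝ)`. -/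
def segre (x : Fin 3 → ℙ ℝ (Fin 2 → ℝ)) : ℙ ℝ ((Fin 3 → Fin 2) → ℝ) :=
  Projectivization.mk ℝ _ (segre_ne_zero x)

/-- The embedding of `ℂ₀ × ℂ³ × ℙ⁵(ℝ) × ℙ¹(ℝ)³` in `ℂ₀ × ℂ³ × ℙ⁵(ℝ) × ℙ⁷(ℝ)` given by the Segre
embedding. -/
def segreMap (q : SpaceT) : Space₂ :=
  adjoinPoint (adjoinPoint (q.1, fun k => k.elim) (q.2 none)) (segre fun s => q.2 (some s))

end

/-! All the spaces have explicit equations. Write `v` for the side-vectors, `x` for a representative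
of the point of `ℙ⁵`, `y s` for one of the argument of side `s`, `w` for one of the point of `ℙ⁷`.
The first blowup consists of the pairs where `v` and `x` have sum zero and `v` is parallel to `x`
(`Incident`). Triangles satisfy in addition that each side of `x` is parallel to `y s`
(`mem_triangles_image_iff`), and points of the second blowup that `w` is a pure tensor with factors
parallel to the sides of `x` (`mem_blowup₂_iff`). The Segre embedding therefore matches the last
two; its inverse reads the factors off slices of `w`.

Each graph satisfies the equations, hence so does its closure. Conversely, every solution is a limit
of points of the graph along a curve (`mem_zariskiClosure_of_curve`). For the first blowup `v = c •
x`, and the sides `(c + t) • x` do. For the second, the delicate points are those where a side of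
`x` is zero. Only one side can be, the other two being then opposite and nonzero; letting it grow as
`t` times the prescribed `y z` realizes every argument (`pointOf_mem_blowup₂`).

That the proposed generators generate the ideal sheaf comes from a polynomial retraction `ψ` onto
the center, or onto one of its components: if `G` vanishes there, so does `G ∘ ψ` on the variety,
and `G - G ∘ ψ` is a combination of the differences `X - ψ X` (`exists_sub_substitution`), which are
multiples of the generators up to a local unit. Smoothness is the Jacobian criterion on charts, with
10 equations in dimension 16 for triangles and 14 in dimension 20 for the second blowup; both
Jacobians are eliminated row by row. -/

noncomputable section

/-! ### Multihomogeneous polynomials evaluated in arbitrary homogeneous coordinates. -/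

section MultiProjectiveGeometry

variable {A κ : Type} {ι : κ → Type}

/-- The coordinate vector with affine part `a` and homogeneous parts `y k`. -/
def homCoords (a : A → ℝ) (y : ∀ k, ι k → ℝ) : A ⊕ (Σ k, ι k) → ℝ :=
  Sum.elim a fun x => y x.1 x.2

/-- The point with affine coordinates `a` and homogeneous coordinates `y k`. -/
def pointOf (a : A → ℝ) (y : ∀ k, ι k → ℝ) (hy : ∀ k, y k ≠ 0) : MultiProj A ι :=
  (a, fun k => Projectivization.mk ℝ (y k) (hy k))

theorem valAt_add (F G : CoordRing A ι) (p : MultiProj A ι) :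
    valAt (F + G) p = valAt F p + valAt G p := map_add _ _ _

theorem valAt_sub (F G : CoordRing A ι) (p : MultiProj A ι) :
    valAt (F - G) p = valAt F p - valAt G p := map_sub _ _ _

theorem valAt_mul (F G : CoordRing A ι) (p : MultiProj A ι) :
    valAt (F * G) p = valAt F p * valAt G p := map_mul _ _ _

theorem valAt_sum {J : Type} (s : Finset J) (F : J → CoordRing A ι) (p : MultiProj A ι) :
    valAt (∑ j ∈ s, F j) p = ∑ j ∈ s, valAt (F j) p := map_sum _ _ _

theorem valAt_prod {J : Type} (s : Finset J) (F : J → CoordRing A ι) (p : MultiProj A ι) :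
    valAt (∏ j ∈ s, F j) p = ∏ j ∈ s, valAt (F j) p := map_prod _ _ _

theorem valAt_zero (p : MultiProj A ι) : valAt (0 : CoordRing A ι) p = 0 := map_zero _

theorem valAt_one (p : MultiProj A ι) : valAt (1 : CoordRing A ι) p = 1 := map_one _

theorem valAt_X (x : A ⊕ (Σ k, ι k)) (p : MultiProj A ι) :
    valAt (MvPolynomial.X x) p = coordVec p x := MvPolynomial.eval_X _

/-- A character `χ` of the monoid of multidegrees encodes an independent rescaling in every
projective factor at once. -/
theorem eval_scale_monomial {σ : Type} (χ : Multiplicative (κ → ℕ) →* ℝ) (w : σ → κ → ℕ)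
    (f : σ → ℝ) (m : σ →₀ ℕ) (r : ℝ) :
    MvPolynomial.eval (fun x => χ (Multiplicative.ofAdd (w x)) * f x)
        (MvPolynomial.monomial m r) =
      χ (Multiplicative.ofAdd (Finsupp.weight w m)) *
        MvPolynomial.eval f (MvPolynomial.monomial m r) := by
  simp only [MvPolynomial.eval_monomial, mul_pow, Finsupp.prod_mul]
  have : χ (Multiplicative.ofAdd (Finsupp.weight w m)) =
      m.prod fun x n => χ (Multiplicative.ofAdd (w x)) ^ n := by
    rw [Finsupp.weight_apply, Finsupp.sum, ofAdd_sum, map_prod, Finsupp.prod]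
    refine Finset.prod_congr rfl fun x _ => ?_
    rw [ofAdd_nsmul, map_pow]
  rw [this]
  ring

theorem eval_scale_of_isWeightedHomogeneous {σ : Type} (χ : Multiplicative (κ → ℕ) →* ℝ)
    {w : σ → κ → ℕ} {G : MvPolynomial σ ℝ} {d : κ → ℕ}
    (hG : MvPolynomial.IsWeightedHomogeneous w G d) (f : σ → ℝ) :
    MvPolynomial.eval (fun x => χ (Multiplicative.ofAdd (w x)) * f x) G =
      χ (Multiplicative.ofAdd d) * MvPolynomial.eval f G := by
  conv_lhs => rw [G.as_sum]
  conv_rhs => rw [G.as_sum]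
  rw [map_sum, map_sum, Finset.mul_sum]
  refine Finset.sum_congr rfl fun m hm => ?_
  rw [eval_scale_monomial, hG (MvPolynomial.mem_support_iff.1 hm)]

/-- The character `n ↦ ∏ k, c k ^ n k` of the group of multidegrees. -/
def scaleChar [Fintype κ] (c : κ → ℝ) : Multiplicative (κ → ℕ) →* ℝ where
  toFun n := ∏ k, c k ^ (n.toAdd k)
  map_one' := by simp
  map_mul' m n := by simp [pow_add, Finset.prod_mul_distrib]

theorem scaleChar_ofAdd [Fintype κ] (c : κ → ℝ) (d : κ → ℕ) :
    scaleChar c (Multiplicative.ofAdd d) = ∏ k, c k ^ d k := rfl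

theorem eval_homCoords_smul [Fintype κ] {G : CoordRing A ι} {d : κ → ℕ} (hG : IsMultiHom G d)
    (c : κ → ℝ) (a : A → ℝ) (y : ∀ k, ι k → ℝ) :
    MvPolynomial.eval (homCoords a fun k => c k • y k) G =
      (∏ k, c k ^ d k) * MvPolynomial.eval (homCoords a y) G := by
  classical
  rw [← scaleChar_ofAdd, ← eval_scale_of_isWeightedHomogeneous (scaleChar c) hG]
  congr 2
  funext x
  rcases x with x | ⟨k, i⟩
  · simp [multiWeight, homCoords]
  · have : multiWeight A ι (Sum.inr ⟨k, i⟩) = Pi.single k 1 := by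
      simp only [multiWeight, Sum.elim_inr]
    rw [this, scaleChar_ofAdd, Finset.prod_eq_single k]
    · simp [homCoords]
    · intro b _ hb
      simp [Pi.single_eq_of_ne hb]
    · simp

theorem exists_coordVec_pointOf (a : A → ℝ) (y : ∀ k, ι k → ℝ) (hy : ∀ k, y k ≠ 0) :
    ∃ c : κ → ℝ, (∀ k, c k ≠ 0) ∧
      coordVec (pointOf a y hy) = homCoords a fun k => c k • y k := by
  have h : ∀ k, ∃ c : ℝ, c ≠ 0 ∧ (Projectivization.mk ℝ (y k) (hy k)).rep = c • y k := by
    intro k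
    obtain ⟨c, hc⟩ := Projectivization.exists_smul_eq_mk_rep ℝ (y k) (hy k)
    exact ⟨c, c.ne_zero, hc.symm⟩
  choose c hc hc' using h
  refine ⟨c, hc, ?_⟩
  funext x
  rcases x with x | ⟨k, i⟩
  · rfl
  · exact congrFun (hc' k) i

/-- The representative `rep` is an arbitrary choice with no continuity; this exchanges it for given
coordinates `y`, with scalars `c` that do not depend on `G`. -/
theorem valAt_pointOf [Fintype κ] (a : A → ℝ) (y : ∀ k, ι k → ℝ) (hy : ∀ k, y k ≠ 0) :
    ∃ c : κ → ℝ, (∀ k, c k ≠ 0) ∧ ∀ (G : CoordRing A ι) (d : κ → ℕ), IsMultiHom G d →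
      valAt G (pointOf a y hy) = (∏ k, c k ^ d k) * MvPolynomial.eval (homCoords a y) G := by
  obtain ⟨c, hc, h⟩ := exists_coordVec_pointOf a y hy
  refine ⟨c, hc, fun G d hG => ?_⟩
  rw [valAt, h, eval_homCoords_smul hG]

theorem valAt_pointOf_eq_zero_iff [Fintype κ] {G : CoordRing A ι} {d : κ → ℕ}
    (hG : IsMultiHom G d) (a : A → ℝ) (y : ∀ k, ι k → ℝ) (hy : ∀ k, y k ≠ 0) :
    valAt G (pointOf a y hy) = 0 ↔ MvPolynomial.eval (homCoords a y) G = 0 := by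
  obtain ⟨c, hc, h⟩ := valAt_pointOf a y hy
  rw [h G d hG, mul_eq_zero, or_iff_right]
  exact Finset.prod_ne_zero_iff.2 fun k _ => pow_ne_zero _ (hc k)

/-! ### Zariski closures -/

theorem subset_zariskiClosure (S : Set (MultiProj A ι)) : S ⊆ zariskiClosure S :=
  fun p hp _ _ _ h => h p hp

theorem zariskiClosure_mono {S T : Set (MultiProj A ι)} (h : S ⊆ T) :
    zariskiClosure S ⊆ zariskiClosure T :=
  fun _ hp d G hG hT => hp d G hG fun q hq => hT q (h hq)

theorem isAlgebraicSet_zariskiClosure (S : Set (MultiProj A ι)) :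
    IsAlgebraicSet (zariskiClosure S) :=
  Set.Subset.antisymm (fun _ hp d G hG hS => hp d G hG fun _ hq => hq d G hG hS)
    (subset_zariskiClosure _)

theorem IsAlgebraicSet.zariskiClosure_subset {S V : Set (MultiProj A ι)} (hV : IsAlgebraicSet V)
    (h : S ⊆ V) : zariskiClosure S ⊆ V :=
  (zariskiClosure_mono h).trans hV.subset

theorem isAlgebraicSet_commonZeros {J : Type} (f : J → CoordRing A ι)
    (hf : ∀ j, ∃ d, IsMultiHom (f j) d) : IsAlgebraicSet {p | ∀ j, valAt (f j) p = 0} := by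
  refine Set.Subset.antisymm (fun p hp j => ?_) (subset_zariskiClosure _)
  obtain ⟨d, hd⟩ := hf j
  exact hp d (f j) hd fun q hq => hq j

-- In explicit coordinates `G` is continuous along the curve and zero for small `t ≠ 0`, hence zero
-- at `t = 0`.
open Filter Topology in
theorem mem_zariskiClosure_of_curve [Fintype κ] {S : Set (MultiProj A ι)} (a : ℝ → A → ℝ)
    (y : ℝ → ∀ k, ι k → ℝ) (ha : Continuous a) (hy : Continuous y) (h0 : ∀ k, y 0 k ≠ 0)
    (h : ∀ᶠ t in 𝓝[≠] (0 : ℝ), ∃ ht : ∀ k, y t k ≠ 0, pointOf (a t) (y t) ht ∈ S) :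
    pointOf (a 0) (y 0) h0 ∈ zariskiClosure S := by
  intro d G hG hS
  rw [valAt_pointOf_eq_zero_iff hG]
  have hc : Continuous fun t => MvPolynomial.eval (homCoords (a t) (y t)) G := by
    refine (MvPolynomial.continuous_eval G).comp (continuous_pi fun x => ?_)
    rcases x with x | ⟨k, i⟩
    · exact (continuous_apply x).comp ha
    · exact (continuous_apply i).comp ((continuous_apply k).comp hy)
  have h1 : Tendsto (fun t => MvPolynomial.eval (homCoords (a t) (y t)) G) (𝓝[≠] 0)
      (𝓝 (MvPolynomial.eval (homCoords (a 0) (y 0)) G)) :=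
    (hc.tendsto 0).mono_left nhdsWithin_le_nhds
  have h2 : Tendsto (fun t => MvPolynomial.eval (homCoords (a t) (y t)) G) (𝓝[≠] 0) (𝓝 0) := by
    refine tendsto_const_nhds.congr' ?_
    filter_upwards [h] with t ht
    obtain ⟨h3, h4⟩ := ht
    exact ((valAt_pointOf_eq_zero_iff hG _ _ h3).1 (hS _ h4)).symm
  exact tendsto_nhds_unique h1 h2

/-! ### Homogeneity -/

theorem isMultiHom_X_inl (x : A) :
    IsMultiHom (MvPolynomial.X (Sum.inl x) : CoordRing A ι) 0 :=
  MvPolynomial.isWeightedHomogeneous_X ℝ (multiWeight A ι) (Sum.inl x)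

theorem isMultiHom_X (x : A ⊕ (Σ k, ι k)) :
    IsMultiHom (MvPolynomial.X x : CoordRing A ι) (multiWeight A ι x) :=
  MvPolynomial.isWeightedHomogeneous_X ℝ (multiWeight A ι) x

theorem IsMultiHom.mul {F G : CoordRing A ι} {d e : κ → ℕ} (hF : IsMultiHom F d)
    (hG : IsMultiHom G e) : IsMultiHom (F * G) (d + e) :=
  MvPolynomial.IsWeightedHomogeneous.mul hF hG

theorem IsMultiHom.add {F G : CoordRing A ι} {d : κ → ℕ} (hF : IsMultiHom F d)
    (hG : IsMultiHom G d) : IsMultiHom (F + G) d :=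
  MvPolynomial.IsWeightedHomogeneous.add hF hG

theorem IsMultiHom.sub {F G : CoordRing A ι} {d : κ → ℕ} (hF : IsMultiHom F d)
    (hG : IsMultiHom G d) : IsMultiHom (F - G) d :=
  MvPolynomial.IsWeightedHomogeneous.sub hF hG

theorem IsMultiHom.neg {F : CoordRing A ι} {d : κ → ℕ} (hF : IsMultiHom F d) :
    IsMultiHom (-F) d :=
  MvPolynomial.IsWeightedHomogeneous.neg hF

theorem isMultiHom_zero (d : κ → ℕ) : IsMultiHom (0 : CoordRing A ι) d :=
  MvPolynomial.isWeightedHomogeneous_zero ℝ _ d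

theorem isMultiHom_sum {J : Type} {s : Finset J} {F : J → CoordRing A ι} {d : κ → ℕ}
    (hF : ∀ j ∈ s, IsMultiHom (F j) d) : IsMultiHom (∑ j ∈ s, F j) d :=
  MvPolynomial.IsWeightedHomogeneous.sum s F d hF

theorem isMultiHom_prod {J : Type} {s : Finset J} {F : J → CoordRing A ι} {d : J → κ → ℕ}
    (hF : ∀ j ∈ s, IsMultiHom (F j) (d j)) : IsMultiHom (∏ j ∈ s, F j) (∑ j ∈ s, d j) :=
  MvPolynomial.IsWeightedHomogeneous.prod s F d hF

theorem isMultiHom_X_inr {k : κ} (i : ι k) [DecidableEq κ] :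
    IsMultiHom (MvPolynomial.X (Sum.inr ⟨k, i⟩) : CoordRing A ι) (Pi.single k 1) := by
  convert isMultiHom_X (A := A) (ι := ι) (Sum.inr ⟨k, i⟩)
  simp only [multiWeight, Sum.elim_inr]
  congr!

/-- An arbitrary finite index type lets the equations be grouped by kind in a sum type. -/
theorem isSmoothVariety_of_equations [Fintype κ] {V : Set (MultiProj A ι)} {n : ℕ}
    (hV : IsAlgebraicSet V)
    (h : ∀ p ∈ V, ∃ (J : Type) (_ : Fintype J) (f : J → CoordRing A ι) (S : CoordRing A ι),
      Fintype.card J + n = ambientDim A ι ∧ (∀ j, ∃ d, IsMultiHom (f j) d) ∧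
      (∀ j, ∀ q ∈ V, valAt (f j) q = 0) ∧ (∃ e, IsMultiHom S e) ∧ valAt S p ≠ 0 ∧
      (∀ q, valAt S q ≠ 0 → (∀ j, valAt (f j) q = 0) → q ∈ V) ∧
      LinearIndependent ℝ (fun j => fun x => valAt (MvPolynomial.pderiv x (f j)) p)) :
    IsSmoothVariety V n := by
  refine ⟨hV, fun p hp => ?_⟩
  obtain ⟨J, _, f, S, hc, hf, hfV, ⟨e, he⟩, hS, hcut, hli⟩ := h p hp
  choose d hd using hf
  let ε := Fintype.equivFin J
  refine ⟨Fintype.card J, fun j => f (ε.symm j), fun j => d (ε.symm j), S, e, hc, fun j => hd _,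
    fun j => hfV _, he, hS, fun q hq hz => hcut q hq fun j => ?_, ?_⟩
  · simpa using hz (ε j)
  · exact hli.comp _ ε.symm.injective

/-! ### Differences under a substitution of variables -/

theorem eval_aeval_eq {σ τ : Type} (ψ : σ → MvPolynomial τ ℝ) (f : τ → ℝ)
    (G : MvPolynomial σ ℝ) :
    MvPolynomial.eval f (MvPolynomial.aeval ψ G) =
      MvPolynomial.eval (fun x => MvPolynomial.eval f (ψ x)) G := by
  induction G using MvPolynomial.induction_on with
  | C r => simp [MvPolynomial.algebraMap_eq]
  | add p q hp hq => simp only [map_add, hp, hq]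
  | mul_X p x hp => simp only [map_mul, hp, MvPolynomial.aeval_X, MvPolynomial.eval_X]

/-- Induction through `p * X n - ψ(p) * ψ n = (p - ψ(p)) * ψ n + p * (X n - ψ n)`. The coefficient
`D x` should have degree `e - w x`; as `M` has no subtraction, its degree is expressed through the
products `D x * P`. -/
theorem exists_sub_substitution {σ M : Type} [Fintype σ] [AddCommMonoid M] (w : σ → M)
    (ψ : σ → MvPolynomial σ ℝ) (hψ : ∀ x, MvPolynomial.IsWeightedHomogeneous w (ψ x) (w x))
    (G : MvPolynomial σ ℝ) (e : M) (hG : MvPolynomial.IsWeightedHomogeneous w G e) :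
    ∃ D : σ → MvPolynomial σ ℝ,
      (∀ x P, MvPolynomial.IsWeightedHomogeneous w P (w x) →
        MvPolynomial.IsWeightedHomogeneous w (D x * P) e) ∧
      G - MvPolynomial.aeval ψ G = ∑ x, D x * (MvPolynomial.X x - ψ x) := by
  classical
  have hmul : ∀ (m : σ →₀ ℕ) (r : ℝ), ∃ e' : M,
      MvPolynomial.IsWeightedHomogeneous w (MvPolynomial.monomial m r) e' ∧
      ∃ D : σ → MvPolynomial σ ℝ,
      (∀ x P, MvPolynomial.IsWeightedHomogeneous w P (w x) →
        MvPolynomial.IsWeightedHomogeneous w (D x * P) e') ∧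
      MvPolynomial.monomial m r - MvPolynomial.aeval ψ (MvPolynomial.monomial m r) =
        ∑ x, D x * (MvPolynomial.X x - ψ x) := by
    refine MvPolynomial.induction_on_monomial (fun r => ?_) (fun p n hp => ?_)
    · refine ⟨0, MvPolynomial.isWeightedHomogeneous_C w r, fun _ => 0, fun x P _ => ?_, ?_⟩
      · rw [zero_mul]
        exact MvPolynomial.isWeightedHomogeneous_zero ℝ w _
      · simp [MvPolynomial.algebraMap_eq]
    · obtain ⟨e', hp, D, hD, h⟩ := hp
      refine ⟨e' + w n, hp.mul (MvPolynomial.isWeightedHomogeneous_X ℝ w n),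
        fun x => D x * ψ n + if x = n then p else 0, fun x P hP => ?_, ?_⟩
      · rw [add_mul]
        refine MvPolynomial.IsWeightedHomogeneous.add ?_ ?_
        · rw [mul_right_comm]
          exact (hD x P hP).mul (hψ n)
        · split_ifs with hx
          · subst hx
            exact hp.mul hP
          · rw [zero_mul]
            exact MvPolynomial.isWeightedHomogeneous_zero ℝ w _
      · simp only [add_mul, Finset.sum_add_distrib, ite_mul, zero_mul, Finset.sum_ite_eq',
          Finset.mem_univ, if_true, mul_right_comm _ (ψ n), ← Finset.sum_mul]
        rw [← h, map_mul, MvPolynomial.aeval_X]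
        ring
  induction hG using MvPolynomial.IsWeightedHomogeneous.induction_on with
  | zero =>
    refine ⟨fun _ => 0, fun x P _ => ?_, by simp⟩
    rw [zero_mul]
    exact MvPolynomial.isWeightedHomogeneous_zero ℝ w _
  | add p q _ _ hp hq =>
    obtain ⟨D, hD, h⟩ := hp
    obtain ⟨E, hE, h'⟩ := hq
    refine ⟨fun x => D x + E x, fun x P hP => ?_, ?_⟩
    · rw [add_mul]
      exact (hD x P hP).add (hE x P hP)
    · simp only [add_mul, Finset.sum_add_distrib, ← h, ← h', map_add]
      ring
  | monomial m r hr =>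
    by_cases hr0 : r = 0
    · refine ⟨fun _ => 0, fun x P _ => ?_, by simp [hr0]⟩
      rw [zero_mul]
      exact MvPolynomial.isWeightedHomogeneous_zero ℝ w _
    · obtain ⟨e', he', D, hD, h⟩ := hmul m r
      -- The induction on monomials builds its own degree `e'`. A nonzero monomial has only one
      -- degree; zero, which has all of them, was split off.
      have : e' = e := MvPolynomial.IsWeightedHomogeneous.inj_right (w := w)
        (by simpa using hr0) he' (MvPolynomial.isWeightedHomogeneous_monomial w m r hr)
      exact ⟨D, this ▸ hD, h⟩

end MultiProjectiveGeometry

/-! ### Side-vectors incident with a direction. -/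

section Incidence

/-- The side coordinates of a point of `ℂ₀ × ℂ³`. -/
def sidePart (a : AffCoord → ℝ) : SideCoord → ℝ := fun x => a (some x.1, x.2)

/-- Replace the side coordinates of `a` by `v`. -/
def withSides (a : AffCoord → ℝ) (v : SideCoord → ℝ) : AffCoord → ℝ :=
  fun c => c.1.elim (a c) fun s => v (s, c.2)

@[simp] theorem sidePart_withSides (a : AffCoord → ℝ) (v : SideCoord → ℝ) :
    sidePart (withSides a v) = v := rfl

@[simp] theorem withSides_sidePart (a : AffCoord → ℝ) : withSides a (sidePart a) = a := by
  funext ⟨o, i⟩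
  cases o <;> rfl

theorem continuous_withSides (a : AffCoord → ℝ) {v : ℝ → SideCoord → ℝ} (hv : Continuous v) :
    Continuous fun t => withSides a (v t) := by
  refine continuous_pi fun ⟨o, i⟩ => ?_
  cases o with
  | none => exact continuous_const
  | some s => exact (continuous_apply (s, i)).comp hv

/-- Side-vectors `v` with sum zero together with a direction `x` of sum zero parallel to `v`. -/
structure Incident (v x : SideCoord → ℝ) : Prop where
  sum_left : ∀ i, ∑ s, v (s, i) = 0
  sum_right : ∀ i, ∑ s, x (s, i) = 0
  parallel : ∀ p q, v p * x q = v q * x p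

theorem Incident.smul_right {v x : SideCoord → ℝ} (h : Incident v x) (c : ℝ) :
    Incident v (c • x) where
  sum_left := h.sum_left
  sum_right i := by simp [← Finset.mul_sum, h.sum_right i]
  parallel p q := by
    simp only [Pi.smul_apply, smul_eq_mul]
    linear_combination c * h.parallel p q

theorem incident_smul_right_iff {v x : SideCoord → ℝ} {c : ℝ} (hc : c ≠ 0) :
    Incident v (c • x) ↔ Incident v x :=
  ⟨fun h => by simpa [smul_smul, hc] using h.smul_right c⁻¹, fun h => h.smul_right c⟩

theorem incident_smul_left {x : SideCoord → ℝ} (hx : ∀ i, ∑ s, x (s, i) = 0) (c : ℝ) :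
    Incident (c • x) x where
  sum_left i := by simp [← Finset.mul_sum, hx i]
  sum_right := hx
  parallel p q := by
    simp only [Pi.smul_apply, smul_eq_mul]
    ring

theorem Incident.exists_eq_smul {v x : SideCoord → ℝ} (h : Incident v x) (hx : x ≠ 0) :
    ∃ c : ℝ, v = c • x := by
  obtain ⟨p, hp⟩ := Function.ne_iff.1 hx
  have hp' : x p ≠ 0 := hp
  refine ⟨v p / x p, funext fun q => ?_⟩
  simp only [Pi.smul_apply, smul_eq_mul]
  field_simp
  exact h.parallel q p

/-- The equations of `Incident`, for given side variables and direction variables. -/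
def incidenceEqs {σ : Type} (V R : SideCoord → MvPolynomial σ ℝ) :
    Fin 2 ⊕ Fin 2 ⊕ (SideCoord × SideCoord) → MvPolynomial σ ℝ :=
  Sum.elim (fun i => ∑ s, V (s, i)) (Sum.elim (fun i => ∑ s, R (s, i))
    fun x => V x.1 * R x.2 - V x.2 * R x.1)

theorem eval_incidenceEqs_eq_zero_iff {σ : Type} (V R : SideCoord → MvPolynomial σ ℝ) (f : σ → ℝ) :
    (∀ j, MvPolynomial.eval f (incidenceEqs V R j) = 0) ↔
      Incident (fun x => MvPolynomial.eval f (V x)) (fun x => MvPolynomial.eval f (R x)) := by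
  simp only [incidenceEqs, Sum.forall, Sum.elim_inl, Sum.elim_inr, map_sum, map_sub, map_mul,
    sub_eq_zero, Prod.forall]
  exact ⟨fun h => ⟨h.1, h.2.1, fun p q => h.2.2 _ _ _ _⟩,
    fun h => ⟨h.1, h.2, fun _ _ _ _ => h.3 _ _⟩⟩

/-- The variable of a side coordinate. -/
def sideVar {κ : Type} (ι : κ → Type) (x : SideCoord) : CoordRing AffCoord ι :=
  MvPolynomial.X (Sum.inl (some x.1, x.2))

theorem isMultiHom_sideVar {κ : Type} (ι : κ → Type) (x : SideCoord) :
    IsMultiHom (sideVar ι x) 0 := isMultiHom_X_inl _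

theorem isMultiHom_incidenceEqs {κ : Type} {ι : κ → Type} {R : SideCoord → CoordRing AffCoord ι}
    {w : κ → ℕ} (hR : ∀ x, IsMultiHom (R x) w) (j : Fin 2 ⊕ Fin 2 ⊕ (SideCoord × SideCoord)) :
    ∃ d, IsMultiHom (incidenceEqs (sideVar ι) R j) d := by
  rcases j with i | i | x
  · exact ⟨0, show IsMultiHom (∑ s, sideVar ι (s, i)) 0 from
      isMultiHom_sum fun s _ => isMultiHom_sideVar ι _⟩
  · exact ⟨w, show IsMultiHom (∑ s, R (s, i)) w from isMultiHom_sum fun s _ => hR _⟩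
  · exact ⟨0 + w, ((isMultiHom_sideVar ι _).mul (hR _)).sub ((isMultiHom_sideVar ι _).mul (hR _))⟩

end Incidence

/-! ### The base and the first blowup -/

theorem toComplex_eq_zero_iff (x : Fin 2 → ℝ) : toComplex x = 0 ↔ ∀ i, x i = 0 := by
  rw [Complex.ext_iff, Fin.forall_fin_two]
  rfl

theorem exists_eq_affPoint (p : Space₀) :
    p = affPoint (affEquiv.symm p.1).1 (affEquiv.symm p.1).2 := by
  refine Prod.ext ?_ (funext fun k => k.elim)
  simp [affPoint]

theorem sum_eq_zero_iff_reIm (v : Fin 3 → ℂ) :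
    ∑ s, v s = 0 ↔ ∀ i, ∑ s, reIm (v s) i = 0 := by
  rw [Complex.ext_iff, Fin.forall_fin_two, Complex.re_sum, Complex.im_sum]
  rfl

theorem eq_zero_iff_reIm (z : ℂ) : z = 0 ↔ ∀ i, reIm z i = 0 := by
  rw [Complex.ext_iff, Fin.forall_fin_two]
  rfl

theorem sidePart_affPoint (b : ℂ) (v : Fin 3 → ℂ) : sidePart (affPoint b v).1 = sideVec v := rfl

theorem mem_baseSpace_iff (p : Space₀) :
    p ∈ baseSpace ↔ ∀ i, ∑ s, sidePart p.1 (s, i) = 0 := by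
  constructor
  · rintro ⟨b, v, h, rfl⟩
    exact (sum_eq_zero_iff_reIm v).1 h
  · intro h
    refine ⟨_, _, ?_, exists_eq_affPoint p⟩
    rw [exists_eq_affPoint p] at h
    exact (sum_eq_zero_iff_reIm _).2 h

theorem sideVec_eq_zero_iff (v : Fin 3 → ℂ) : sideVec v = 0 ↔ v = 0 := by
  constructor
  · intro h
    funext s
    exact (eq_zero_iff_reIm _).2 fun i => congrFun h (s, i)
  · rintro rfl
    funext ⟨s, i⟩
    exact (eq_zero_iff_reIm 0).1 rfl i

theorem mem_originLocus_iff (p : Space₀) : p ∈ originLocus ↔ sidePart p.1 = 0 := by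
  constructor
  · rintro ⟨b, rfl⟩
    exact (sideVec_eq_zero_iff 0).2 rfl
  · intro h
    refine ⟨(affEquiv.symm p.1).1, ?_⟩
    have := exists_eq_affPoint p
    rw [this, sidePart_affPoint, sideVec_eq_zero_iff] at h
    rw [h] at this
    exact this

theorem mem_doubleLocus_iff (p : Space₀) :
    p ∈ doubleLocus ↔ (∀ i, ∑ s, sidePart p.1 (s, i) = 0) ∧ ∃ s, ∀ i, sidePart p.1 (s, i) = 0 := by
  constructor
  · rintro ⟨b, v, h, ⟨s, hs⟩, rfl⟩
    exact ⟨(sum_eq_zero_iff_reIm v).1 h, s, (eq_zero_iff_reIm _).1 hs⟩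
  · rintro ⟨h, s, hs⟩
    rw [exists_eq_affPoint p] at h hs
    exact ⟨_, _, (sum_eq_zero_iff_reIm _).2 h, ⟨s, (eq_zero_iff_reIm _).2 hs⟩,
      exists_eq_affPoint p⟩

theorem valAt_sideVar {κ : Type} {ι : κ → Type} (x : SideCoord) (p : MultiProj AffCoord ι) :
    valAt (sideVar ι x) p = sidePart p.1 x := by
  simp [valAt, sideVar, coordVec, sidePart]

theorem isAlgebraicSet_baseSpace : IsAlgebraicSet baseSpace := by
  have h : baseSpace = {p | ∀ i : Fin 2, valAt (∑ s, sideVar noFactor (s, i)) p = 0} := by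
    ext p
    rw [mem_baseSpace_iff]
    simp only [valAt_sum, Set.mem_ofPred_eq, valAt_sideVar]
  rw [h]
  exact isAlgebraicSet_commonZeros _ fun i =>
    ⟨0, isMultiHom_sum fun s _ => isMultiHom_sideVar _ _⟩

theorem isAlgebraicSet_originLocus : IsAlgebraicSet originLocus := by
  have h : originLocus = {p | ∀ x, valAt (sideVar noFactor x) p = 0} := by
    ext p
    rw [mem_originLocus_iff]
    simp only [Set.mem_ofPred_eq, valAt_sideVar, funext_iff, Pi.zero_apply]
  rw [h]
  exact isAlgebraicSet_commonZeros _ fun x => ⟨0, isMultiHom_sideVar _ _⟩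

theorem originLocus_subset_baseSpace : originLocus ⊆ baseSpace := by
  intro p hp
  rw [mem_originLocus_iff] at hp
  rw [mem_baseSpace_iff]
  simp [hp]

theorem isMultiHom_noFactor {A : Type} (G : CoordRing A noFactor) (d : Empty → ℕ) :
    IsMultiHom G d := fun _ _ => Subsingleton.elim _ _

/-- The substitution `ψ` sets the six side coordinates to zero, which retracts the whole space onto
the origin locus. The terms left in `G - G ∘ ψ` are multiples of these coordinates, so the
denominator `1` suffices. -/
theorem generatesIdealOf_originEqs : GeneratesIdealOf baseSpace originLocus originEqs 0 := by
  classical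
  refine ⟨fun j => isMultiHom_noFactor _ _, fun j q hq => ?_, fun p _ G e _ hG => ?_⟩
  · exact (valAt_sideVar j q).trans (congrFun ((mem_originLocus_iff q).1 hq) j)
  · let ψ : AffCoord ⊕ (Σ k, noFactor k) → CoordRing AffCoord noFactor :=
      Sum.elim (fun c => c.1.elim (MvPolynomial.X (Sum.inl c)) fun _ => 0) fun k => k.1.elim
    -- Without projective factors homogeneity is no condition, so the trivial grading by `Unit` is
    -- enough.
    obtain ⟨D, -, hD⟩ := exists_sub_substitution (fun _ => (0 : Unit)) ψ
      (fun _ => fun _ _ => rfl) G 0 fun _ _ => rfl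
    refine ⟨1, 0, fun x => D (Sum.inl (some x.1, x.2)), 0, isMultiHom_noFactor _ _,
      fun j => isMultiHom_noFactor _ _, Subsingleton.elim _ _, by simp [valAt], fun q _ => ?_⟩
    have h0 : valAt (MvPolynomial.aeval ψ G) q = 0 := by
      have : valAt (MvPolynomial.aeval ψ G) q =
          valAt G ((withSides q.1 0, q.2) : Space₀) := by
        rw [valAt, valAt, eval_aeval_eq]
        congr 2
        funext x
        rcases x with ⟨o, i⟩ | ⟨k, _⟩
        · cases o <;> simp [ψ, coordVec, withSides]
        · exact k.elim
      rw [this]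
      exact hG _ ((mem_originLocus_iff _).2 rfl)
    have h1 := congrArg (fun P => valAt P q) hD
    simp only [valAt, map_sub, map_sum, map_mul] at h1 h0 ⊢
    rw [h0, sub_zero] at h1
    rw [h1, map_one, one_mul, Fintype.sum_sum_type, Fintype.sum_prod_type, Fintype.sum_option,
      ← Fintype.sum_prod_type']
    simp [ψ, originEqs]

theorem mem_ratGraph_originEqs_iff (q : Space₁) :
    q ∈ ratGraph baseSpace originEqs ↔ (∀ i, ∑ s, sidePart q.1 (s, i) = 0) ∧
      ∃ h : sidePart q.1 ≠ 0, q.2 none = Projectivization.mk ℝ (sidePart q.1) h := by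
  have hval : ∀ p : Space₀, (fun j => valAt (originEqs j) p) = sidePart p.1 :=
    fun p => funext fun j => valAt_sideVar j p
  constructor
  · rintro ⟨p, hp, h, rfl⟩
    rw [mem_baseSpace_iff] at hp
    refine ⟨hp, hval p ▸ h, ?_⟩
    simp only [adjoinPoint, hval]
  · rintro ⟨h0, h, hq⟩
    refine ⟨(q.1, fun k => k.elim), (mem_baseSpace_iff _).2 h0, (hval _).symm ▸ h, ?_⟩
    refine Prod.ext rfl (funext fun o => ?_)
    cases o with
    | none => simpa only [adjoinPoint, hval] using hq
    | some k => exact k.elim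

/-- The variable of a homogeneous coordinate of `ℙ⁵` in `ℂ₀ × ℂ³ × ℙ⁵`. -/
def dirVar₁ (x : SideCoord) : CoordRing AffCoord (adjoin noFactor SideCoord) :=
  MvPolynomial.X (Sum.inr ⟨none, x⟩)

theorem isMultiHom_dirVar₁ (x : SideCoord) : IsMultiHom (dirVar₁ x) (Pi.single none 1) := by
  exact isMultiHom_X_inr (ι := adjoin noFactor SideCoord) (k := none) x

theorem valAt_dirVar₁ (x : SideCoord) (q : Space₁) : valAt (dirVar₁ x) q = (q.2 none).rep x := by
  simp [valAt, dirVar₁, coordVec]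

theorem eventually_add_ne_zero (c : ℝ) : ∀ᶠ t in nhdsWithin (0 : ℝ) {0}ᶜ, c + t ≠ 0 := by
  by_cases hc : c = 0
  · filter_upwards [self_mem_nhdsWithin] with t ht
    simpa [hc] using ht
  · have : ∀ᶠ t in nhds (0 : ℝ), c + t ≠ 0 :=
      (continuous_const.add continuous_id).continuousAt.eventually_ne (by simpa using hc)
    exact this.filter_mono nhdsWithin_le_nhds

/-- Homogeneous coordinates for `ℂ₀ × ℂ³ × ℙ⁵`. -/
def dirCoords (x : SideCoord → ℝ) : ∀ k, adjoin noFactor SideCoord k → ℝ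
  | none => x
  | some k => k.elim

theorem dirCoords_ne_zero {x : SideCoord → ℝ} (hx : x ≠ 0) (k : Option Empty) :
    dirCoords x k ≠ 0 := by
  cases k with
  | none => exact hx
  | some k => exact k.elim

theorem eq_pointOf_dirCoords (q : Space₁) :
    q = pointOf q.1 (dirCoords (q.2 none).rep) (dirCoords_ne_zero (q.2 none).rep_nonzero) := by
  refine Prod.ext rfl (funext fun o => ?_)
  cases o with
  | none => exact (Projectivization.mk_rep _).symm
  | some k => exact k.elim

theorem incident_rep_iff (v : SideCoord → ℝ) {x : SideCoord → ℝ} (hx : x ≠ 0) :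
    Incident v (Projectivization.mk ℝ x hx).rep ↔ Incident v x := by
  obtain ⟨c, hc⟩ := Projectivization.exists_smul_eq_mk_rep ℝ x hx
  rw [← hc]
  exact incident_smul_right_iff c.ne_zero

/-- A point of the cone over the first blowup is the limit of points with nonzero sides. -/
theorem mem_zariskiClosure_of_sides_scaled {S : Set Space₁} (q : Space₁)
    (h : Incident (sidePart q.1) (q.2 none).rep)
    (hS : ∀ c : ℝ, c ≠ 0 → (withSides q.1 (c • (q.2 none).rep), q.2) ∈ S) :
    q ∈ zariskiClosure S := by
  obtain ⟨c, hc⟩ := h.exists_eq_smul (q.2 none).rep_nonzero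
  have hq := eq_pointOf_dirCoords q
  have key := mem_zariskiClosure_of_curve (S := S)
    (fun t => withSides q.1 ((c + t) • (q.2 none).rep))
    (fun _ => dirCoords (q.2 none).rep) (continuous_withSides _ (by fun_prop)) continuous_const
    (dirCoords_ne_zero (q.2 none).rep_nonzero) (by
      filter_upwards [eventually_add_ne_zero c] with t ht
      refine ⟨dirCoords_ne_zero (q.2 none).rep_nonzero, ?_⟩
      convert hS _ ht using 1
      exact Prod.ext rfl (congrArg Prod.snd hq).symm)
  simp only [add_zero, ← hc, withSides_sidePart] at key
  rwa [← hq] at key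

/-- On the graph the direction is the class of `v` itself, so the equations hold there. Conversely,
scaling the sides to `c • x` with `c ≠ 0` keeps the direction and lands in the graph. -/
theorem blowup₁_eq :
    blowup₁ = {q | ∀ j, valAt (incidenceEqs (sideVar _) dirVar₁ j) q = 0} := by
  have hmem : ∀ q : Space₁, (∀ j, valAt (incidenceEqs (sideVar _) dirVar₁ j) q = 0) ↔
      Incident (sidePart q.1) (q.2 none).rep := by
    intro q
    refine (eval_incidenceEqs_eq_zero_iff _ _ _).trans ?_
    simp only [← valAt.eq_def, valAt_sideVar, valAt_dirVar₁]
  apply Set.Subset.antisymm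
  · refine IsAlgebraicSet.zariskiClosure_subset
      (isAlgebraicSet_commonZeros _ (isMultiHom_incidenceEqs isMultiHom_dirVar₁)) fun q hq => ?_
    obtain ⟨h0, h, hq⟩ := (mem_ratGraph_originEqs_iff q).1 hq
    rw [Set.mem_ofPred_eq, hmem, hq, incident_rep_iff]
    simpa using incident_smul_left h0 1
  · intro q hq
    rw [Set.mem_ofPred_eq, hmem] at hq
    refine mem_zariskiClosure_of_sides_scaled q hq fun c hc => ?_
    refine (mem_ratGraph_originEqs_iff _).2
      ⟨(incident_smul_left hq.sum_right c).sum_left, smul_ne_zero hc (q.2 none).rep_nonzero, ?_⟩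
    rw [← Projectivization.mk_rep (q.2 none)]
    refine (Projectivization.mk_eq_mk_iff' _ _ _ _ _).2 ⟨c⁻¹, ?_⟩
    simp [sidePart_withSides, smul_smul, hc]

theorem mem_blowup₁_iff (q : Space₁) :
    q ∈ blowup₁ ↔ Incident (sidePart q.1) (q.2 none).rep := by
  rw [blowup₁_eq]
  refine (eval_incidenceEqs_eq_zero_iff _ _ _).trans ?_
  simp only [← valAt.eq_def, valAt_sideVar, valAt_dirVar₁]

theorem isBlowup_blowup₁ : IsBlowup baseSpace originLocus originEqs 0 blowup₁ :=
  ⟨isAlgebraicSet_baseSpace, isAlgebraicSet_originLocus, originLocus_subset_baseSpace,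
    generatesIdealOf_originEqs, rfl⟩

/-! ### The strict transform of the double point locus -/

theorem prod_choice_eq_zero_iff (x : SideCoord → ℝ) :
    (∀ e : Fin 3 → Fin 2, ∏ s, x (s, e s) = 0) ↔ ∃ s, ∀ i, x (s, i) = 0 := by
  constructor
  · intro h
    by_contra! hx
    choose e he using hx
    exact Finset.prod_ne_zero_iff.2 (fun s _ => he s) (h e)
  · rintro ⟨s, hs⟩ e
    exact Finset.prod_eq_zero (Finset.mem_univ s) (hs _)

theorem valAt_doubleEqs (e : Fin 3 → Fin 2) (q : Space₁) :
    valAt (doubleEqs e) q = ∏ s, (q.2 none).rep (s, e s) := by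
  simp [valAt, doubleEqs, coordVec]

theorem isMultiHom_doubleEqs (e : Fin 3 → Fin 2) : IsMultiHom (doubleEqs e) fun _ => 3 := by
  have h : IsMultiHom (doubleEqs e) (∑ _s : Fin 3, Pi.single (none : Option Empty) 1) :=
    isMultiHom_prod fun s _ => isMultiHom_dirVar₁ (s, e s)
  convert h using 1
  funext o
  cases o with
  | none => simp
  | some k => exact k.elim

/-- Where `v ≠ 0`, a zero side of `v` forces the same side of `x` to be zero, so the eight monomials
vanish on the closure. Conversely, the sides `c • x` with `c ≠ 0` keep the zero side and avoid the
origin. -/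
theorem mem_doubleStrict_iff (q : Space₁) :
    q ∈ doubleStrict ↔ q ∈ blowup₁ ∧ ∃ s, ∀ i, (q.2 none).rep (s, i) = 0 := by
  constructor
  · intro hq
    have hB : q ∈ blowup₁ :=
      (isAlgebraicSet_zariskiClosure _).zariskiClosure_subset (fun _ h => h.1) hq
    refine ⟨hB, (prod_choice_eq_zero_iff _).1 fun e => ?_⟩
    rw [← valAt_doubleEqs]
    refine hq _ _ (isMultiHom_doubleEqs e) fun p hp => ?_
    obtain ⟨hpB, hpd, hpo⟩ := hp
    rw [mem_blowup₁_iff] at hpB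
    obtain ⟨-, s, hs⟩ := (mem_doubleLocus_iff _).1 hpd
    rw [mem_originLocus_iff] at hpo
    obtain ⟨x, hx⟩ := Function.ne_iff.1 hpo
    rw [valAt_doubleEqs]
    refine (prod_choice_eq_zero_iff _).2 ⟨s, fun i => ?_⟩ e
    have h1 := hpB.parallel x (s, i)
    have h2 : sidePart p.1 (s, i) = 0 := hs i
    rw [h2, zero_mul] at h1
    exact (mul_eq_zero.1 h1).resolve_left hx
  · rintro ⟨hB, s, hs⟩
    rw [mem_blowup₁_iff] at hB
    refine mem_zariskiClosure_of_sides_scaled q hB fun c hc => ?_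
    have hc' := incident_smul_left hB.sum_right c
    refine ⟨(mem_blowup₁_iff _).2 hc', (mem_doubleLocus_iff _).2 ⟨hc'.sum_left, s, fun i => ?_⟩,
      fun h => ?_⟩
    · simp [dropPoint, hs i]
    · exact smul_ne_zero hc (q.2 none).rep_nonzero ((mem_originLocus_iff _).1 h)

theorem sum_fin_three_eq {M : Type} [AddCommMonoid M] (z : Fin 3) (f : Fin 3 → M) :
    ∑ s, f s = f z + f (z + 1) + f (z + 2) := by
  rw [Fin.sum_univ_three]
  fin_cases z
  · rfl
  · show f 0 + f 1 + f 2 = f 1 + f 2 + f 0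
    rw [add_assoc, add_comm]
  · show f 0 + f 1 + f 2 = f 2 + f 0 + f 1
    rw [add_comm, add_assoc]

theorem prod_fin_three_eq {M : Type} [CommMonoid M] (z : Fin 3) (f : Fin 3 → M) :
    ∏ s, f s = f z * f (z + 1) * f (z + 2) := by
  rw [Fin.prod_univ_three]
  fin_cases z
  · rfl
  · show f 0 * f 1 * f 2 = f 1 * f 2 * f 0
    rw [mul_assoc, mul_comm]
  · show f 0 * f 1 * f 2 = f 2 * f 0 * f 1
    rw [mul_comm, mul_assoc]

/-- Collapse the side `z`: replace it by zero and the side `z + 2` by the negative of `z + 1`. -/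
def collapseSide {R : Type} [Ring R] (z : Fin 3) (x : SideCoord → R) : SideCoord → R :=
  fun p => if p.1 = z then 0 else if p.1 = z + 1 then x p else -x (z + 1, p.2)

section collapseSide

variable {R : Type} [Ring R] (z : Fin 3) (x : SideCoord → R) (i : Fin 2)

theorem collapseSide_self : collapseSide z x (z, i) = 0 := by simp [collapseSide]

theorem collapseSide_add_one : collapseSide z x (z + 1, i) = x (z + 1, i) := by simp [collapseSide]

theorem collapseSide_add_two : collapseSide z x (z + 2, i) = -x (z + 1, i) := by simp [collapseSide]

theorem sum_collapseSide : ∑ s, collapseSide z x (s, i) = 0 := by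
  rw [sum_fin_three_eq z, collapseSide_self, collapseSide_add_one, collapseSide_add_two]
  simp

end collapseSide

theorem collapseSide_smul (z : Fin 3) (c : ℝ) (x : SideCoord → ℝ) :
    collapseSide z (c • x) = c • collapseSide z x := by
  funext p
  simp only [collapseSide, Pi.smul_apply, smul_eq_mul, mul_ite, mul_zero, mul_neg]

theorem eval_collapseSide {σ : Type} (f : σ → ℝ) (z : Fin 3) (M : SideCoord → MvPolynomial σ ℝ)
    (p : SideCoord) :
    MvPolynomial.eval f (collapseSide z M p) =
      collapseSide z (fun x => MvPolynomial.eval f (M x)) p := by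
  simp only [collapseSide]
  split_ifs <;> simp

theorem isMultiHom_collapseSide {κ : Type} {ι : κ → Type} {M : SideCoord → CoordRing AffCoord ι}
    {d : κ → ℕ} (hM : ∀ x, IsMultiHom (M x) d) (z : Fin 3) (p : SideCoord) :
    IsMultiHom (collapseSide z M p) d := by
  simp only [collapseSide]
  split_ifs
  · exact isMultiHom_zero d
  · exact hM p
  · exact (hM _).neg

theorem multiWeight_dirVar₁ (x : SideCoord) :
    multiWeight AffCoord (adjoin noFactor SideCoord) (Sum.inr ⟨none, x⟩) = Pi.single none 1 := by
  simp only [multiWeight, Sum.elim_inr]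
  congr!

/-- The substitution collapsing the side `z` in the affine and the homogeneous coordinates. -/
def collapseSubst (z : Fin 3) : AffCoord ⊕ (Σ k, adjoin noFactor SideCoord k) →
    CoordRing AffCoord (adjoin noFactor SideCoord)
  | Sum.inl (none, i) => MvPolynomial.X (Sum.inl (none, i))
  | Sum.inl (some s, i) => collapseSide z (sideVar _) (s, i)
  | Sum.inr ⟨none, x⟩ => collapseSide z dirVar₁ x
  | Sum.inr ⟨some k, _⟩ => k.elim

theorem isMultiHom_collapseSubst (z : Fin 3) (x : AffCoord ⊕ (Σ k, adjoin noFactor SideCoord k)) :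
    IsMultiHom (collapseSubst z x) (multiWeight AffCoord (adjoin noFactor SideCoord) x) := by
  rcases x with ⟨_ | s, i⟩ | ⟨_ | k, x⟩
  · exact isMultiHom_X_inl _
  · exact isMultiHom_collapseSide (d := 0) (isMultiHom_sideVar (adjoin noFactor SideCoord)) z (s, i)
  · rw [multiWeight_dirVar₁ x]
    have h : IsMultiHom (collapseSide z dirVar₁ x) (Pi.single none 1) :=
      isMultiHom_collapseSide isMultiHom_dirVar₁ z x
    exact h
  · exact k.elim

theorem valAt_collapseSubst (z : Fin 3) (q : Space₁) :
    (fun x => valAt (collapseSubst z x) q) =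
      homCoords (withSides q.1 (collapseSide z (sidePart q.1)))
        (dirCoords (collapseSide z (q.2 none).rep)) := by
  funext x
  rcases x with ⟨_ | s, i⟩ | ⟨_ | k, x⟩
  · simp [valAt, collapseSubst, homCoords, withSides, coordVec]
  · rw [collapseSubst, valAt, eval_collapseSide]
    simp only [← valAt.eq_def, valAt_sideVar]
    rfl
  · rw [collapseSubst, valAt, eval_collapseSide]
    simp only [← valAt.eq_def, valAt_dirVar₁]
    rfl
  · exact k.elim

/-- Collapsing commutes with scalars, so `v = c • x` is preserved and the collapsed point lies on
the component of the strict transform where side `z` is zero. The hypothesis `hi` keeps the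
collapsed direction nonzero, so that it does define a point. -/
theorem valAt_aeval_collapseSubst {G : CoordRing AffCoord (adjoin noFactor SideCoord)}
    {e : Option Empty → ℕ} (hG : IsMultiHom G e) (hG0 : ∀ q ∈ doubleStrict, valAt G q = 0)
    {z : Fin 3} {q : Space₁} (hq : q ∈ blowup₁) {i : Fin 2}
    (hi : (q.2 none).rep (z + 1, i) ≠ 0) :
    valAt (MvPolynomial.aeval (collapseSubst z) G) q = 0 := by
  rw [mem_blowup₁_iff] at hq
  have hx : collapseSide z (q.2 none).rep ≠ 0 :=
    Function.ne_iff.2 ⟨(z + 1, i), by rwa [collapseSide_add_one]⟩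
  rw [valAt, eval_aeval_eq]
  refine (congrArg (fun f => MvPolynomial.eval f G) (valAt_collapseSubst z q)).trans ?_
  refine (valAt_pointOf_eq_zero_iff hG _ _ (dirCoords_ne_zero hx)).1 (hG0 _ ?_)
  have hp : (pointOf (withSides q.1 (collapseSide z (sidePart q.1)))
      (dirCoords (collapseSide z (q.2 none).rep)) (dirCoords_ne_zero hx) : Space₁).2 none =
        Projectivization.mk ℝ _ hx := rfl
  rw [mem_doubleStrict_iff, mem_blowup₁_iff, hp, incident_rep_iff]
  obtain ⟨c, hc⟩ := hq.exists_eq_smul (q.2 none).rep_nonzero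
  refine ⟨?_, z, fun j => ?_⟩
  · rw [hc, collapseSide_smul]
    exact incident_smul_left (fun j => sum_collapseSide z _ j) c
  · obtain ⟨a, ha⟩ := Projectivization.exists_smul_eq_mk_rep ℝ _ hx
    rw [← ha, Pi.smul_apply, collapseSide_self, smul_zero]

instance adjoinFintype {κ : Type} {ι : κ → Type} {J : Type} [Fintype J] [∀ k, Fintype (ι k)] :
    ∀ o, Fintype (adjoin ι J o)
  | none => inferInstanceAs (Fintype J)
  | some k => inferInstanceAs (Fintype (ι k))

theorem sum_variables {M : Type} [AddCommMonoid M] (z : Fin 3)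
    (f : AffCoord ⊕ (Σ k, adjoin noFactor SideCoord k) → M) :
    ∑ x, f x = ∑ k : Fin 2, (f (Sum.inl (none, k)) + (f (Sum.inl (some z, k)) +
      f (Sum.inl (some (z + 1), k)) + f (Sum.inl (some (z + 2), k)))) +
      ∑ k : Fin 2, (f (Sum.inr ⟨none, (z, k)⟩) + f (Sum.inr ⟨none, (z + 1, k)⟩) +
        f (Sum.inr ⟨none, (z + 2, k)⟩)) := by
  rw [Fintype.sum_sum_type, Fintype.sum_prod_type_right, Fintype.sum_sigma, Fintype.sum_option]
  congr 1
  · refine Finset.sum_congr rfl fun k _ => ?_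
    rw [Fintype.sum_option, sum_fin_three_eq z]
  · rw [Finset.univ_eq_empty (α := Empty), Finset.sum_empty, add_zero]
    refine (Fintype.sum_prod_type_right (α₁ := Fin 3) (α₂ := Fin 2) _).trans ?_
    exact Finset.sum_congr rfl fun k _ => sum_fin_three_eq z _

/-- Near a point where side `z` of `x` is zero, some `x (z + 1, i)` is nonzero and `x (z + 2, i)` is
its negative at that point, so both are local units. The differences left by collapsing side `z` are
`±x (z, k)` and `±v (z, k)`, by the sum relations, and parallelism turns `v (z, k) * x (z + 1, i)`
into a multiple of `x (z, k)`. Away from the center some monomial is itself a local unit. -/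
theorem generatesIdealOf_doubleEqs :
    GeneratesIdealOf blowup₁ doubleStrict doubleEqs fun _ => 3 := by
  classical
  refine ⟨isMultiHom_doubleEqs, fun e q hq => ?_, fun p hp G e hG hG0 => ?_⟩
  · rw [valAt_doubleEqs]
    exact (prod_choice_eq_zero_iff _).2 ((mem_doubleStrict_iff q).1 hq).2 e
  by_cases hps : ∃ s, ∀ i, (p.2 none).rep (s, i) = 0
  · obtain ⟨z, hz⟩ := hps
    rw [mem_blowup₁_iff] at hp
    have hsum : ∀ i, (p.2 none).rep (z + 2, i) = -(p.2 none).rep (z + 1, i) := by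
      intro i
      have := hp.sum_right i
      rw [sum_fin_three_eq z, hz i] at this
      linarith
    obtain ⟨i, hi⟩ : ∃ i, (p.2 none).rep (z + 1, i) ≠ 0 := by
      by_contra! h
      refine (p.2 none).rep_nonzero (funext fun ⟨s, i⟩ => ?_)
      have hs : s = z ∨ s = z + 1 ∨ s = z + 2 := by
        clear * -
        revert s z
        decide
      rcases hs with rfl | rfl | rfl
      · exact hz i
      · exact h i
      · rw [hsum, h i]
        exact neg_zero
    obtain ⟨D, hDhom, hD⟩ := exists_sub_substitution _ (collapseSubst z)
      (isMultiHom_collapseSubst z) G e hG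
    -- The monomial with index `ec k` is `x (z, k) * x (z + 1, i) * x (z + 2, i)`; only these two
    -- monomials are used.
    let ec : Fin 2 → Fin 3 → Fin 2 := fun k => Function.update (fun _ => i) z k
    -- Each `D` is multiplied by a variable of the weight of its own index, so `Q k` has degree `e`.
    -- The minus signs reflect that the difference on side `z + 2` is the negative of the coordinate
    -- on side `z`.
    let Q : Fin 2 → CoordRing AffCoord (adjoin noFactor SideCoord) := fun k =>
      (D (Sum.inr ⟨none, (z, k)⟩) * dirVar₁ (z + 1, i) -
        D (Sum.inr ⟨none, (z + 2, k)⟩) * dirVar₁ (z + 1, i)) +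
      (D (Sum.inl (some z, k)) * sideVar _ (z + 1, i) -
        D (Sum.inl (some (z + 2), k)) * sideVar _ (z + 1, i))
    have hDR : ∀ s k, IsMultiHom (D (Sum.inr ⟨none, (s, k)⟩) * dirVar₁ (z + 1, i)) e := fun s k =>
      hDhom _ _ (by rw [multiWeight_dirVar₁]; exact isMultiHom_dirVar₁ _)
    have hDV : ∀ s k, IsMultiHom (D (Sum.inl (some s, k)) * sideVar _ (z + 1, i)) e := fun s k =>
      hDhom _ _ (isMultiHom_sideVar _ _)
    have hQ : ∀ k, IsMultiHom (Q k) e := fun k =>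
      ((hDR _ _).sub (hDR _ _)).add ((hDV _ _).sub (hDV _ _))
    -- One factor `x (z + 1, i)` trades `v (z, k)` for `x (z, k)`; the other two factors complete `x
    -- (z, k)` to a monomial.
    refine ⟨dirVar₁ (z + 1, i) * dirVar₁ (z + 1, i) * dirVar₁ (z + 2, i), fun _ => 3,
      fun f => ∑ k, if f = ec k then Q k else 0, e, ?_, fun f => isMultiHom_sum fun k _ => ?_,
      add_comm _ _, ?_, fun q hq => ?_⟩
    · convert ((isMultiHom_dirVar₁ (z + 1, i)).mul (isMultiHom_dirVar₁ (z + 1, i))).mul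
        (isMultiHom_dirVar₁ (z + 2, i)) using 1
      funext o
      cases o with
      | none => simp
      | some k => exact k.elim
    · split_ifs
      · exact hQ k
      · exact isMultiHom_zero e
    · simp only [valAt_mul, valAt_dirVar₁, hsum]
      simpa using hi
    · have hR : ∑ f, valAt (∑ k, if f = ec k then Q k else 0) q * valAt (doubleEqs f) q =
          ∑ k, valAt (Q k) q * ((q.2 none).rep (z, k) * (q.2 none).rep (z + 1, i) *
            (q.2 none).rep (z + 2, i)) := by
        have h1 : ∀ f, valAt (∑ k, if f = ec k then Q k else 0) q =
            ∑ k, if f = ec k then valAt (Q k) q else 0 := by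
          intro f
          rw [valAt_sum]
          refine Finset.sum_congr rfl fun k _ => ?_
          split_ifs
          · rfl
          · exact valAt_zero q
        simp only [h1, Finset.sum_mul]
        rw [Finset.sum_comm]
        refine Finset.sum_congr rfl fun k _ => ?_
        simp only [ite_mul, zero_mul, Finset.sum_ite_eq', Finset.mem_univ, if_true]
        rw [valAt_doubleEqs, prod_fin_three_eq z]
        simp [ec]
      rw [hR]
      -- The identity is needed on all of `blowup₁`. Where collapsing might not give a point, both
      -- sides contain the factor `x (z + 1, i) = 0`.
      by_cases hqi : (q.2 none).rep (z + 1, i) = 0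
      · simp [valAt_mul, valAt_dirVar₁, hqi]
      have hcol := valAt_aeval_collapseSubst hG hG0 hq hqi
      rw [mem_blowup₁_iff] at hq
      have hψ : ∀ x, MvPolynomial.eval (coordVec q) (collapseSubst z x) = _ :=
        congrFun (valAt_collapseSubst z q)
      have hval : valAt G q = ∑ x, valAt (D x) q * (coordVec q x -
          homCoords (withSides q.1 (collapseSide z (sidePart q.1)))
            (dirCoords (collapseSide z (q.2 none).rep)) x) := by
        have h1 := congrArg (fun P => valAt P q) hD
        simp only [valAt, map_sub, map_sum, map_mul, hψ, MvPolynomial.eval_X] at h1 hcol ⊢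
        rwa [hcol, sub_zero] at h1
      have hQval : ∀ k, valAt (Q k) q =
          (valAt (D (Sum.inr ⟨none, (z, k)⟩)) q * (q.2 none).rep (z + 1, i) -
            valAt (D (Sum.inr ⟨none, (z + 2, k)⟩)) q * (q.2 none).rep (z + 1, i)) +
          (valAt (D (Sum.inl (some z, k))) q * sidePart q.1 (z + 1, i) -
            valAt (D (Sum.inl (some (z + 2), k))) q * sidePart q.1 (z + 1, i)) := by
        intro k
        simp only [Q, valAt_add, valAt_sub, valAt_mul, valAt_dirVar₁, valAt_sideVar]
      have hS : valAt (dirVar₁ (z + 1, i) * dirVar₁ (z + 1, i) * dirVar₁ (z + 2, i)) q =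
          (q.2 none).rep (z + 1, i) * (q.2 none).rep (z + 1, i) * (q.2 none).rep (z + 2, i) := by
        simp only [valAt_mul, valAt_dirVar₁]
      rw [hS, hval, sum_variables z, ← Finset.sum_add_distrib, Finset.mul_sum]
      refine Finset.sum_congr rfl fun k _ => ?_
      have hV := hq.sum_left k
      have hX := hq.sum_right k
      rw [sum_fin_three_eq z] at hV hX
      have e0 : coordVec q (Sum.inl (none, k)) = q.1 (none, k) := rfl
      have e1 : ∀ s, coordVec q (Sum.inl (some s, k)) = sidePart q.1 (s, k) := fun s => rfl
      have e2 : ∀ s, coordVec q (Sum.inr ⟨none, (s, k)⟩) = (q.2 none).rep (s, k) := fun s => rfl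
      have e3 : ∀ (v x : SideCoord → ℝ), homCoords (withSides q.1 v) (dirCoords x)
          (Sum.inl (none, k)) = q.1 (none, k) := fun v x => rfl
      have e4 : ∀ (v x : SideCoord → ℝ) s, homCoords (withSides q.1 v) (dirCoords x)
          (Sum.inl (some s, k)) = v (s, k) := fun v x s => rfl
      have e5 : ∀ (v x : SideCoord → ℝ) s, homCoords (withSides q.1 v) (dirCoords x)
          (Sum.inr ⟨none, (s, k)⟩) = x (s, k) := fun v x s => rfl
      rw [hQval, e0, e3]
      simp only [e1, e2, e4, e5, collapseSide_self, collapseSide_add_one, collapseSide_add_two]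
      have hpar := hq.parallel (z, k) (z + 1, i)
      generalize valAt (D (Sum.inr ⟨none, (z, k)⟩)) q = d₁
      generalize valAt (D (Sum.inr ⟨none, (z + 2, k)⟩)) q = d₂
      generalize valAt (D (Sum.inl (some z, k))) q = d₃
      generalize valAt (D (Sum.inl (some (z + 2), k))) q = d₄
      linear_combination (q.2 none).rep (z + 1, i) * (q.2 none).rep (z + 2, i) *
        ((q.2 none).rep (z + 1, i) * (d₄ * hV + d₂ * hX) + (d₃ - d₄) * hpar)
  · have : ∃ f, valAt (doubleEqs f) p ≠ 0 := by
      by_contra! h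
      exact hps ((prod_choice_eq_zero_iff _).1 fun f => (valAt_doubleEqs f p) ▸ h f)
    obtain ⟨f, hf⟩ := this
    refine ⟨doubleEqs f, fun _ => 3, fun j => if j = f then G else 0, e, isMultiHom_doubleEqs f,
      fun j => ?_, add_comm _ _, hf, fun q _ => ?_⟩
    · dsimp only
      split_ifs
      · exact hG
      · exact isMultiHom_zero e
    · rw [Finset.sum_eq_single f]
      · simp [mul_comm]
      · intro j _ hj
        simp [hj, valAt]
      · simp

/-! ### Parallel directions and the Segre embedding -/

/-- The vectors `x` and `y` of the plane are linearly dependent. -/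
def IsParallel (x y : Fin 2 → ℝ) : Prop := x 0 * y 1 = x 1 * y 0

theorem isParallel_smul_right_iff {x y : Fin 2 → ℝ} {c : ℝ} (hc : c ≠ 0) :
    IsParallel x (c • y) ↔ IsParallel x y := by
  simp only [IsParallel, Pi.smul_apply, smul_eq_mul]
  rw [mul_left_comm, mul_left_comm (x 1)]
  exact mul_right_inj' hc

theorem isParallel_rep_iff (x : Fin 2 → ℝ) {y : Fin 2 → ℝ} (hy : y ≠ 0) :
    IsParallel x (Projectivization.mk ℝ y hy).rep ↔ IsParallel x y := by
  obtain ⟨c, hc⟩ := Projectivization.exists_smul_eq_mk_rep ℝ y hy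
  rw [← hc]
  exact isParallel_smul_right_iff c.ne_zero

theorem IsParallel.exists_eq_smul {x y : Fin 2 → ℝ} (h : IsParallel x y) (hy : y ≠ 0) :
    ∃ c : ℝ, x = c • y := by
  unfold IsParallel at h
  obtain ⟨i, hi⟩ := Function.ne_iff.1 hy
  have hi' : y i ≠ 0 := hi
  refine ⟨x i / y i, funext fun j => ?_⟩
  simp only [Pi.smul_apply, smul_eq_mul]
  field_simp
  fin_cases i <;> fin_cases j <;> simp <;> linarith

/-- The tensor product of three vectors of the plane. -/
def tensorVec (y : Fin 3 → Fin 2 → ℝ) : (Fin 3 → Fin 2) → ℝ := fun e => ∏ s, y s (e s)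

theorem tensorVec_ne_zero {y : Fin 3 → Fin 2 → ℝ} (hy : ∀ s, y s ≠ 0) : tensorVec y ≠ 0 := by
  have h : ∀ s, ∃ i, y s i ≠ 0 := fun s => Function.ne_iff.1 (hy s)
  choose e he using h
  exact Function.ne_iff.2 ⟨e, Finset.prod_ne_zero_iff.2 fun s _ => he s⟩

theorem tensorVec_smul (c : Fin 3 → ℝ) (y : Fin 3 → Fin 2 → ℝ) :
    tensorVec (fun s => c s • y s) = (∏ s, c s) • tensorVec y := by
  funext e
  simp [tensorVec, Finset.prod_mul_distrib]

theorem tensorVec_update (y : Fin 3 → Fin 2 → ℝ) (e : Fin 3 → Fin 2) (s : Fin 3) (i : Fin 2) :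
    tensorVec y (Function.update e s i) = y s i * ∏ t ∈ Finset.univ.erase s, y t (e t) := by
  rw [tensorVec, ← Finset.mul_prod_erase _ _ (Finset.mem_univ s), Function.update_self]
  congr 1
  refine Finset.prod_congr rfl fun t ht => ?_
  rw [Function.update_of_ne (Finset.ne_of_mem_erase ht)]

theorem segre_mk (y : Fin 3 → Fin 2 → ℝ) (hy : ∀ s, y s ≠ 0) :
    segre (fun s => Projectivization.mk ℝ (y s) (hy s)) =
      Projectivization.mk ℝ (tensorVec y) (tensorVec_ne_zero hy) := by
  have h : ∀ s, ∃ c : ℝ, c ≠ 0 ∧ (Projectivization.mk ℝ (y s) (hy s)).rep = c • y s := by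
    intro s
    obtain ⟨c, hc⟩ := Projectivization.exists_smul_eq_mk_rep ℝ (y s) (hy s)
    exact ⟨c, c.ne_zero, hc.symm⟩
  choose c hc hc' using h
  refine (Projectivization.mk_eq_mk_iff' _ _ _ _ _).2 ⟨∏ s, c s, ?_⟩
  rw [← tensorVec_smul]
  funext e
  simp only [tensorVec, hc']

/-- The vector `z` is a pure tensor whose factors are parallel to the sides of `x`. -/
structure IsCompatible (x : SideCoord → ℝ) (z : (Fin 3 → Fin 2) → ℝ) : Prop where
  parallel : ∀ s e, x (s, 0) * z (Function.update e s 1) = x (s, 1) * z (Function.update e s 0)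
  exchange : ∀ s e f,
    z e * z f = z (Function.update e s (f s)) * z (Function.update f s (e s))

theorem IsCompatible.smul_right {x : SideCoord → ℝ} {z : (Fin 3 → Fin 2) → ℝ}
    (h : IsCompatible x z) (c : ℝ) : IsCompatible x (c • z) where
  parallel s e := by
    simp only [Pi.smul_apply, smul_eq_mul]
    linear_combination c * h.parallel s e
  exchange s e f := by
    simp only [Pi.smul_apply, smul_eq_mul]
    linear_combination c ^ 2 * h.exchange s e f

theorem isCompatible_tensorVec {x : SideCoord → ℝ} {y : Fin 3 → Fin 2 → ℝ}
    (h : ∀ s, IsParallel (fun i => x (s, i)) (y s)) : IsCompatible x (tensorVec y) where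
  parallel s e := by
    have hs : x (s, 0) * y s 1 = x (s, 1) * y s 0 := h s
    rw [tensorVec_update, tensorVec_update, ← mul_assoc, hs, mul_assoc]
  exchange s e f := by
    conv_lhs => rw [← Function.update_eq_self s e, ← Function.update_eq_self s f]
    simp only [tensorVec_update]
    ring

theorem isParallel_self (x : Fin 2 → ℝ) : IsParallel x x := mul_comm _ _

/-- The factors of a pure tensor, read off at a coordinate `e`. -/
def tensorFactor (z : (Fin 3 → Fin 2) → ℝ) (e : Fin 3 → Fin 2) (s : Fin 3) (i : Fin 2) : ℝ :=
  z (Function.update e s i)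

theorem tensorFactor_self (z : (Fin 3 → Fin 2) → ℝ) (e : Fin 3 → Fin 2) (s : Fin 3) :
    tensorFactor z e s (e s) = z e := by
  rw [tensorFactor, Function.update_eq_self]

theorem tensorFactor_ne_zero {z : (Fin 3 → Fin 2) → ℝ} {e : Fin 3 → Fin 2} (h : z e ≠ 0)
    (s : Fin 3) : tensorFactor z e s ≠ 0 :=
  Function.ne_iff.2 ⟨e s, by rwa [tensorFactor_self]⟩

/-- Two exchanges, at the places `0` and `1`, turn `z f * z e ^ 2` into the product of the three
slices through `e`. Hence `z e ≠ 0` makes `z` a pure tensor. -/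
theorem IsCompatible.tensorVec_tensorFactor {x : SideCoord → ℝ} {z : (Fin 3 → Fin 2) → ℝ}
    (h : IsCompatible x z) (e : Fin 3 → Fin 2) :
    tensorVec (tensorFactor z e) = z e ^ 2 • z := by
  funext f
  simp only [tensorVec, tensorFactor, Pi.smul_apply, smul_eq_mul, Fin.prod_univ_three]
  have h0 := h.exchange 0 f e
  have h1 := h.exchange 1 (Function.update f 0 (e 0)) e
  have h2 : Function.update (Function.update f 0 (e 0)) 1 (e 1) = Function.update e 2 (f 2) := by
    funext s
    fin_cases s <;> simp [Function.update]
  rw [h2, Function.update_of_ne (by decide)] at h1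
  linear_combination -z e * h0 - z (Function.update e 0 (f 0)) * h1

theorem IsCompatible.isParallel_tensorFactor {x : SideCoord → ℝ} {z : (Fin 3 → Fin 2) → ℝ}
    (h : IsCompatible x z) (e : Fin 3 → Fin 2) (s : Fin 3) :
    IsParallel (fun i => x (s, i)) (tensorFactor z e s) :=
  h.parallel s e

/-! ### The triangles as a real algebraic set -/

theorem rho_apply (P : ℙ ℝ (Fin 2 → ℝ)) : rho P = argModPi (toComplex P.rep) := by
  conv_lhs => rw [← P.mk_rep]
  rfl

theorem rho_eq_argModPi_iff (P : ℙ ℝ (Fin 2 → ℝ)) {x : Fin 2 → ℝ} (hx : toComplex x ≠ 0) :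
    rho P = argModPi (toComplex x) ↔ IsParallel x P.rep := by
  rw [rho_apply, argModPi_eq_iff (toComplex_ne_zero P.rep_nonzero) hx]
  simp only [toComplex, IsParallel]
  constructor <;> intro h <;> linarith

/-- The cases `v ≠ 0` and `v = 0` merge into `Incident`: parallelism fixes the direction if `v ≠ 0`
and is empty if `v = 0`. Likewise the argument condition becomes bilinear, and the bilinear equation
is empty for a zero side, whose argument is free. -/
theorem mem_triangles_image_iff (q : SpaceT) :
    q ∈ geomVarEquiv '' triangles ↔ Incident (sidePart q.1) (q.2 none).rep ∧
      ∀ s, IsParallel (fun i => (q.2 none).rep (s, i)) (q.2 (some s)).rep := by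
  set v := (affEquiv.symm q.1).2 with hv
  have hside : sideVec v = sidePart q.1 := by
    have := congrArg Prod.fst (exists_eq_affPoint (q.1, fun k => k.elim))
    exact (congrArg sidePart this).symm
  rw [Equiv.image_eq_preimage_symm]
  have hmem : q ∈ geomVarEquiv.symm ⁻¹' triangles ↔ ∑ s, v s = 0 ∧
      (v ≠ 0 → ∃ h : sideVec v ≠ 0, q.2 none = Projectivization.mk ℝ (sideVec v) h) ∧
      (v = 0 → ∀ i, ∑ s, (q.2 none).rep (s, i) = 0) ∧
      (∀ s, toComplex (fun i => (q.2 none).rep (s, i)) ≠ 0 →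
        rho (q.2 (some s)) = argModPi (toComplex (fun i => (q.2 none).rep (s, i)))) := Iff.rfl
  have hpar : (∀ s, toComplex (fun i => (q.2 none).rep (s, i)) ≠ 0 →
        rho (q.2 (some s)) = argModPi (toComplex (fun i => (q.2 none).rep (s, i)))) ↔
      ∀ s, IsParallel (fun i => (q.2 none).rep (s, i)) (q.2 (some s)).rep := by
    refine forall_congr' fun s => ?_
    by_cases hs : toComplex (fun i => (q.2 none).rep (s, i)) = 0
    · have h0 := (toComplex_eq_zero_iff _).1 hs
      exact iff_of_true (fun h => (h hs).elim) (by simp [IsParallel, h0])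
    · rw [← rho_eq_argModPi_iff _ hs]
      exact ⟨fun h => h hs, fun h _ => h⟩
  rw [hmem, hpar, sum_eq_zero_iff_reIm]
  have hsum : (∀ i, ∑ s, reIm (v s) i = 0) ↔ ∀ i, ∑ s, sidePart q.1 (s, i) = 0 := by
    rw [← hside]
    rfl
  rw [hsum, ← and_assoc, ← and_assoc]
  refine and_congr_left fun _ => ?_
  by_cases h0 : v = 0
  · have hs0 : sidePart q.1 = 0 := by rw [← hside, sideVec_eq_zero_iff, h0]
    simp only [h0, ne_eq, not_true_eq_false, false_imp_iff, and_true, true_imp_iff]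
    exact ⟨fun h => ⟨h.1, h.2, fun _ _ => by simp [hs0]⟩,
      fun h => ⟨h.sum_left, h.sum_right⟩⟩
  · have hs0 : sidePart q.1 ≠ 0 := by rwa [← hside, ne_eq, sideVec_eq_zero_iff]
    simp only [h0, ne_eq, not_false_eq_true, true_imp_iff, false_imp_iff, and_true, hside]
    constructor
    · rintro ⟨h1, h, h2⟩
      rw [h2, incident_rep_iff]
      simpa using incident_smul_left h1 1
    · intro h
      refine ⟨h.sum_left, hs0, ?_⟩
      obtain ⟨c, hc⟩ := h.exists_eq_smul (q.2 none).rep_nonzero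
      have hc0 : c ≠ 0 := by
        rintro rfl
        exact hs0 (by rw [hc, zero_smul])
      conv_lhs => rw [← (q.2 none).mk_rep]
      exact (Projectivization.mk_eq_mk_iff' _ _ _ _ _).2
        ⟨c⁻¹, by rw [hc, smul_smul, inv_mul_cancel₀ hc0, one_smul]⟩

/-! ### The second blowup -/

/-- Homogeneous coordinates for `ℂ₀ × ℂ³ × ℙ⁵ × ℙ⁷`. -/
def dirCoords₂ (x : SideCoord → ℝ) (w : (Fin 3 → Fin 2) → ℝ) :
    ∀ k, adjoin (adjoin noFactor SideCoord) (Fin 3 → Fin 2) k → ℝ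
  | none => w
  | some none => x
  | some (some k) => k.elim

theorem dirCoords₂_ne_zero {x : SideCoord → ℝ} {w : (Fin 3 → Fin 2) → ℝ} (hx : x ≠ 0)
    (hw : w ≠ 0) (k : Option (Option Empty)) : dirCoords₂ x w k ≠ 0 := by
  rcases k with _ | _ | k
  · exact hw
  · exact hx
  · exact k.elim

theorem space₂_ext {p q : Space₂} (h : p.1 = q.1) (h1 : p.2 (some none) = q.2 (some none))
    (h2 : p.2 none = q.2 none) : p = q := by
  refine Prod.ext h (funext fun o => ?_)
  rcases o with _ | _ | k
  · exact h2
  · exact h1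
  · exact k.elim

/-- The factor `c` lets a common factor of the eight monomials be removed; along the degenerating
curve it is the parameter `t`. -/
theorem pointOf_mem_ratGraph_doubleEqs {a : AffCoord → ℝ} {x : SideCoord → ℝ}
    {w : (Fin 3 → Fin 2) → ℝ} (hx : x ≠ 0) (hw : w ≠ 0) (h : Incident (sidePart a) x) {c : ℝ}
    (hc : c ≠ 0) (hxw : tensorVec (fun s i => x (s, i)) = c • w) :
    pointOf a (dirCoords₂ x w) (dirCoords₂_ne_zero hx hw) ∈ ratGraph blowup₁ doubleEqs := by
  let p : Space₁ := pointOf a (dirCoords x) (dirCoords_ne_zero hx)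
  obtain ⟨r, hr⟩ := Projectivization.exists_smul_eq_mk_rep ℝ x hx
  have hp : (p.2 none).rep = (r : ℝ) • x := hr.symm
  have hval : (fun e => valAt (doubleEqs e) p) = ((r : ℝ) ^ 3 * c) • w := by
    rw [mul_smul, ← hxw]
    funext e
    simp only [valAt_doubleEqs, hp, tensorVec, Pi.smul_apply, smul_eq_mul, Fin.prod_univ_three]
    ring
  have hne : (r : ℝ) ^ 3 * c ≠ 0 := mul_ne_zero (pow_ne_zero _ r.ne_zero) hc
  refine ⟨p, (mem_blowup₁_iff p).2 ?_, ?_, space₂_ext rfl rfl ?_⟩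
  · rw [hp]
    exact h.smul_right r
  · rw [hval]
    exact smul_ne_zero hne hw
  · refine (Projectivization.mk_eq_mk_iff' _ _ _ _ _).2 ⟨((r : ℝ) ^ 3 * c)⁻¹, ?_⟩
    rw [hval, smul_smul, inv_mul_cancel₀ hne, one_smul]
    rfl

theorem segreMap_eq_pointOf (q : SpaceT) :
    segreMap q = pointOf q.1 (dirCoords₂ (q.2 none).rep (tensorVec fun s => (q.2 (some s)).rep))
      (dirCoords₂_ne_zero (q.2 none).rep_nonzero
        (tensorVec_ne_zero fun s => (q.2 (some s)).rep_nonzero)) :=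
  space₂_ext rfl (q.2 none).mk_rep.symm rfl

/-- If no side of `x` is zero, its tensor is proportional to that of `y` and the point is on the
graph. If side `z` is zero, `x` is deformed so that side `z` becomes `t • y z`. The tensor of the
deformed direction is `t` times `tensorVec (Y t)`, whose limit is a nonzero multiple of `tensorVec
y` because the other two sides of `x` are nonzero. -/
theorem pointOf_mem_blowup₂ {a : AffCoord → ℝ} {x : SideCoord → ℝ} {y : Fin 3 → Fin 2 → ℝ}
    (hx : x ≠ 0) (hy : ∀ s, y s ≠ 0) (hinc : Incident (sidePart a) x)
    (hpar : ∀ s, IsParallel (fun i => x (s, i)) (y s)) :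
    pointOf a (dirCoords₂ x (tensorVec y)) (dirCoords₂_ne_zero hx (tensorVec_ne_zero hy)) ∈
      blowup₂ := by
  have h : ∀ s, ∃ c : ℝ, (fun i => x (s, i)) = c • y s := fun s => (hpar s).exists_eq_smul (hy s)
  choose c hc using h
  by_cases hc0 : ∀ s, c s ≠ 0
  · refine subset_zariskiClosure _ (pointOf_mem_ratGraph_doubleEqs hx (tensorVec_ne_zero hy) hinc
      (c := ∏ s, c s) (Finset.prod_ne_zero_iff.2 fun s _ => hc0 s) ?_)
    rw [← tensorVec_smul]
    exact congrArg tensorVec (funext hc)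
  push Not at hc0
  obtain ⟨z, hz⟩ := hc0
  have hxz : ∀ i, x (z, i) = 0 := fun i => by simpa [hz] using congrFun (hc z) i
  have hx2 : ∀ i, x (z + 2, i) = -x (z + 1, i) := by
    intro i
    have := hinc.sum_right i
    rw [sum_fin_three_eq z, hxz i] at this
    linarith
  have hs : ∀ s, s = z ∨ s = z + 1 ∨ s = z + 2 := by
    clear * -
    revert z
    decide
  have hz1 : z + 1 ≠ z := by simp
  have hz2 : z + 2 ≠ z := by simp
  have hz21 : z + 2 ≠ z + 1 := by simp
  have hx1 : (fun i => x (z + 1, i)) ≠ 0 := by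
    intro h
    refine hx (funext fun ⟨s, i⟩ => ?_)
    have h1 : x (z + 1, i) = 0 := congrFun h i
    rcases hs s with rfl | rfl | rfl
    · exact hxz i
    · exact h1
    · rw [hx2, h1]
      exact neg_zero
  have hx2' : (fun i => x (z + 2, i)) ≠ 0 := by
    intro h
    refine hx1 (funext fun i => ?_)
    have h1 : x (z + 2, i) = 0 := congrFun h i
    rw [hx2, neg_eq_zero] at h1
    exact h1
  have hcs : ∀ s, s ≠ z → c s ≠ 0 := by
    intro s hsz h0
    have h1 := hc s
    rw [h0, zero_smul] at h1
    rcases hs s with rfl | rfl | rfl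
    · exact hsz rfl
    · exact hx1 h1
    · exact hx2' h1
  -- The actual sides are `l` times the direction and stay so along the curve; `l = 0` is allowed,
  -- as the graph is taken over all of `blowup₁`.
  obtain ⟨l, hl⟩ := hinc.exists_eq_smul hx
  -- Side `z + 1` gives up what side `z` gains, which keeps the sum zero.
  let X : ℝ → SideCoord → ℝ := fun t p =>
    if p.1 = z then t * y z p.2 else if p.1 = z + 1 then x p - t * y z p.2 else x p
  let Y : ℝ → Fin 3 → Fin 2 → ℝ := fun t s => if s = z then y z else fun i => X t (s, i)
  have hXc : Continuous X := by
    refine continuous_pi fun p => ?_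
    simp only [X]
    split_ifs <;> fun_prop
  have hYc : Continuous Y := by
    refine continuous_pi fun s => continuous_pi fun i => ?_
    simp only [Y]
    split_ifs
    · exact continuous_const
    · exact (continuous_apply (s, i)).comp hXc
  have hX0 : X 0 = x := by
    funext ⟨s, i⟩
    simp only [X]
    split_ifs with h1 h2
    · subst h1
      simp [hxz]
    · simp
    · rfl
  have hXz : ∀ t i, X t (z, i) = t * y z i := fun t i => if_pos rfl
  have hX1 : ∀ t i, X t (z + 1, i) = x (z + 1, i) - t * y z i := fun t i => by simp [X]
  have hX2 : ∀ t i, X t (z + 2, i) = x (z + 2, i) := fun t i => by simp [X]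
  have hXsum : ∀ t i, ∑ s, X t (s, i) = 0 := by
    intro t i
    rw [sum_fin_three_eq z, hXz, hX1, hX2, hx2]
    ring
  have hYz : ∀ t, Y t z = y z := fun t => if_pos rfl
  have hY1 : ∀ t, Y t (z + 1) = fun i => X t (z + 1, i) := fun t => if_neg hz1
  have hY2 : ∀ t, Y t (z + 2) = fun i => X t (z + 2, i) := fun t => if_neg hz2
  have hXY : ∀ t, tensorVec (fun s i => X t (s, i)) = t • tensorVec (Y t) := by
    intro t
    funext e
    simp only [tensorVec, Pi.smul_apply, smul_eq_mul, prod_fin_three_eq z, hYz, hY1, hY2, hXz]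
    ring
  have hY0 : tensorVec (Y 0) = (c (z + 1) * c (z + 2)) • tensorVec y := by
    have h1 := fun i => congrFun (hc (z + 1)) i
    have h2 := fun i => congrFun (hc (z + 2)) i
    simp only [Pi.smul_apply, smul_eq_mul] at h1 h2
    funext e
    simp only [tensorVec, Pi.smul_apply, smul_eq_mul, prod_fin_three_eq z, hYz, hY1, hY2, hX0, h1,
      h2]
    ring
  have hc12 : c (z + 1) * c (z + 2) ≠ 0 := mul_ne_zero (hcs _ hz1) (hcs _ hz2)
  have hYne0 : tensorVec (Y 0) ≠ 0 := by
    rw [hY0]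
    exact smul_ne_zero hc12 (tensorVec_ne_zero hy)
  have hcur := mem_zariskiClosure_of_curve (S := ratGraph blowup₁ doubleEqs)
    (fun t => withSides a (l • X t)) (fun t => dirCoords₂ (X t) (tensorVec (Y t)))
    (continuous_withSides _ (by fun_prop))
    (by
      refine continuous_pi fun k => ?_
      rcases k with _ | _ | k
      · refine continuous_pi fun e => ?_
        show Continuous fun t => ∏ s, Y t s (e s)
        refine continuous_finsetProd _ fun s _ => ?_
        exact (continuous_apply (e s)).comp ((continuous_apply s).comp hYc)
      · exact hXc
      · exact k.elim)
    (dirCoords₂_ne_zero (hX0.symm ▸ hx) hYne0)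
    (by
      have hev : ∀ᶠ t in nhdsWithin (0 : ℝ) {0}ᶜ, (fun i => X t (z + 1, i)) ≠ 0 := by
        refine Filter.Eventually.filter_mono nhdsWithin_le_nhds ?_
        refine ContinuousAt.eventually_ne (Continuous.continuousAt ?_) ?_
        · exact continuous_pi fun i => (continuous_apply (z + 1, i)).comp hXc
        · simpa only [hX0] using hx1
      filter_upwards [hev, self_mem_nhdsWithin] with t ht1 ht0
      have hXt : X t ≠ 0 := fun h => ht1 (by rw [h]; rfl)
      have hYt : tensorVec (Y t) ≠ 0 := by
        refine tensorVec_ne_zero fun s => ?_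
        rcases hs s with rfl | rfl | rfl
        · rw [hYz]
          exact hy _
        · rw [hY1]
          exact ht1
        · rw [hY2]
          simpa only [hX2] using hx2'
      exact ⟨dirCoords₂_ne_zero hXt hYt, pointOf_mem_ratGraph_doubleEqs hXt hYt
        (incident_smul_left (hXsum t) l) ht0 (hXY t)⟩)
  refine Eq.mp (congrArg (· ∈ blowup₂) (space₂_ext ?_ ?_ ?_)) hcur
  · show withSides a (l • X 0) = a
    rw [hX0, ← hl, withSides_sidePart]
  · refine (Projectivization.mk_eq_mk_iff' _ _ _ _ _).2 ⟨1, ?_⟩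
    rw [one_smul]
    exact hX0.symm
  · refine (Projectivization.mk_eq_mk_iff' _ _ _ _ _).2 ⟨c (z + 1) * c (z + 2), ?_⟩
    exact hY0.symm

theorem segreMap_mem_blowup₂ {q : SpaceT} (hq : q ∈ geomVarEquiv '' triangles) :
    segreMap q ∈ blowup₂ := by
  obtain ⟨hinc, hpar⟩ := (mem_triangles_image_iff q).1 hq
  rw [segreMap_eq_pointOf]
  exact pointOf_mem_blowup₂ (q.2 none).rep_nonzero (fun s => (q.2 (some s)).rep_nonzero) hinc hpar

/-- The variable of a homogeneous coordinate of `ℙ⁵` in `ℂ₀ × ℂ³ × ℙ⁵ × ℙ⁷`. -/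
def dirVar₂ (x : SideCoord) :
    CoordRing AffCoord (adjoin (adjoin noFactor SideCoord) (Fin 3 → Fin 2)) :=
  MvPolynomial.X (Sum.inr ⟨some none, x⟩)

/-- The variable of a homogeneous coordinate of `ℙ⁷`. -/
def tensorVar (e : Fin 3 → Fin 2) :
    CoordRing AffCoord (adjoin (adjoin noFactor SideCoord) (Fin 3 → Fin 2)) :=
  MvPolynomial.X (Sum.inr ⟨none, e⟩)

theorem isMultiHom_dirVar₂ (x : SideCoord) :
    IsMultiHom (dirVar₂ x) (Pi.single (some none) 1) :=
  isMultiHom_X_inr (ι := adjoin (adjoin noFactor SideCoord) (Fin 3 → Fin 2)) (k := some none) x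

theorem isMultiHom_tensorVar (e : Fin 3 → Fin 2) : IsMultiHom (tensorVar e) (Pi.single none 1) :=
  isMultiHom_X_inr (ι := adjoin (adjoin noFactor SideCoord) (Fin 3 → Fin 2)) (k := none) e

theorem valAt_dirVar₂ (x : SideCoord) (q : Space₂) :
    valAt (dirVar₂ x) q = (q.2 (some none)).rep x := valAt_X _ _

theorem valAt_tensorVar (e : Fin 3 → Fin 2) (q : Space₂) :
    valAt (tensorVar e) q = (q.2 none).rep e := valAt_X _ _

/-- The equations of the second blowup. -/
def blowupEqs₂ : (Fin 2 ⊕ Fin 2 ⊕ (SideCoord × SideCoord)) ⊕ (Fin 3 × (Fin 3 → Fin 2)) ⊕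
      (Fin 3 × (Fin 3 → Fin 2) × (Fin 3 → Fin 2)) →
    CoordRing AffCoord (adjoin (adjoin noFactor SideCoord) (Fin 3 → Fin 2)) :=
  Sum.elim (incidenceEqs (sideVar _) dirVar₂) (Sum.elim
    (fun j => dirVar₂ (j.1, 0) * tensorVar (Function.update j.2 j.1 1) -
      dirVar₂ (j.1, 1) * tensorVar (Function.update j.2 j.1 0))
    (fun j => tensorVar j.2.1 * tensorVar j.2.2 -
      tensorVar (Function.update j.2.1 j.1 (j.2.2 j.1)) *
        tensorVar (Function.update j.2.2 j.1 (j.2.1 j.1))))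

theorem isMultiHom_blowupEqs₂ (j) : ∃ d, IsMultiHom (blowupEqs₂ j) d := by
  rcases j with j | j | j
  · exact isMultiHom_incidenceEqs isMultiHom_dirVar₂ j
  · exact ⟨_, ((isMultiHom_dirVar₂ _).mul (isMultiHom_tensorVar _)).sub
      ((isMultiHom_dirVar₂ _).mul (isMultiHom_tensorVar _))⟩
  · exact ⟨_, ((isMultiHom_tensorVar _).mul (isMultiHom_tensorVar _)).sub
      ((isMultiHom_tensorVar _).mul (isMultiHom_tensorVar _))⟩

theorem incidenceEqs_dirVar₂_iff (q : Space₂) :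
    (∀ j, valAt (incidenceEqs (sideVar _) dirVar₂ j) q = 0) ↔
      Incident (sidePart q.1) (q.2 (some none)).rep := by
  refine (eval_incidenceEqs_eq_zero_iff _ _ _).trans ?_
  simp only [← valAt.eq_def, valAt_sideVar, valAt_dirVar₂]

theorem blowupEqs₂_iff (q : Space₂) : (∀ j, valAt (blowupEqs₂ j) q = 0) ↔
    Incident (sidePart q.1) (q.2 (some none)).rep ∧
      IsCompatible (q.2 (some none)).rep (q.2 none).rep := by
  refine Sum.forall.trans (and_congr (incidenceEqs_dirVar₂_iff q) (Sum.forall.trans ?_))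
  simp only [blowupEqs₂, Sum.elim_inr, Sum.elim_inl, valAt_sub, valAt_mul, valAt_dirVar₂,
    valAt_tensorVar, sub_eq_zero, Prod.forall]
  exact ⟨fun h => ⟨h.1, h.2⟩, fun h => ⟨h.1, h.2⟩⟩

theorem mem_blowup₂_conditions {q : Space₂} (hq : q ∈ blowup₂) :
    Incident (sidePart q.1) (q.2 (some none)).rep ∧
      IsCompatible (q.2 (some none)).rep (q.2 none).rep := by
  rw [← blowupEqs₂_iff]
  suffices h : ratGraph blowup₁ doubleEqs ⊆ {q | ∀ j, valAt (blowupEqs₂ j) q = 0} from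
    (isAlgebraicSet_commonZeros _ isMultiHom_blowupEqs₂).zariskiClosure_subset h hq
  clear hq q
  intro q hq
  obtain ⟨p, hp, h, rfl⟩ := hq
  rw [Set.mem_ofPred_eq, blowupEqs₂_iff]
  refine ⟨(mem_blowup₁_iff p).1 hp, ?_⟩
  obtain ⟨c, hc⟩ := Projectivization.exists_smul_eq_mk_rep ℝ _ h
  have hz : ((adjoinPoint p (Projectivization.mk ℝ _ h)).2 none).rep =
      (c : ℝ) • tensorVec (fun s i => (p.2 none).rep (s, i)) := by
    refine hc.symm.trans ?_
    simp only [valAt_doubleEqs]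
    rfl
  rw [hz]
  exact (isCompatible_tensorVec fun s => isParallel_self _).smul_right _

/-- The slices of the tensor through a nonzero coordinate are its factors, and compatibility says
that they are parallel to the sides. -/
theorem exists_segreMap_eq {q : Space₂}
    (h1 : Incident (sidePart q.1) (q.2 (some none)).rep)
    (h2 : IsCompatible (q.2 (some none)).rep (q.2 none).rep) :
    ∃ p ∈ geomVarEquiv '' triangles, segreMap p = q := by
  obtain ⟨e, he⟩ := Function.ne_iff.1 (q.2 none).rep_nonzero
  have he' : (q.2 none).rep e ≠ 0 := he
  have hy := tensorFactor_ne_zero he'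
  let p : SpaceT := (q.1, fun o => match o with
    | none => q.2 (some none)
    | some s => Projectivization.mk ℝ (tensorFactor (q.2 none).rep e s) (hy s))
  refine ⟨p, (mem_triangles_image_iff p).2 ⟨h1, fun s => ?_⟩, space₂_ext rfl rfl ?_⟩
  · exact (isParallel_rep_iff _ (hy s)).2 (h2.isParallel_tensorFactor e s)
  · refine (segre_mk _ hy).trans ?_
    refine Eq.trans ?_ (q.2 none).mk_rep
    exact (Projectivization.mk_eq_mk_iff' _ _ _ _ _).2
      ⟨(q.2 none).rep e ^ 2, (h2.tensorVec_tensorFactor e).symm⟩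

theorem mem_blowup₂_iff (q : Space₂) :
    q ∈ blowup₂ ↔ Incident (sidePart q.1) (q.2 (some none)).rep ∧
      IsCompatible (q.2 (some none)).rep (q.2 none).rep := by
  refine ⟨mem_blowup₂_conditions, fun ⟨h1, h2⟩ => ?_⟩
  obtain ⟨p, hp, rfl⟩ := exists_segreMap_eq h1 h2
  exact segreMap_mem_blowup₂ hp

theorem segreMap_image_triangles : segreMap '' (geomVarEquiv '' triangles) = blowup₂ := by
  apply Set.Subset.antisymm
  · rintro _ ⟨p, hp, rfl⟩
    exact segreMap_mem_blowup₂ hp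
  · intro q hq
    obtain ⟨h1, h2⟩ := mem_blowup₂_conditions hq
    obtain ⟨p, hp, h⟩ := exists_segreMap_eq h1 h2
    exact ⟨p, hp, h⟩

theorem tensorFactor_tensorVec (y : Fin 3 → Fin 2 → ℝ) (e : Fin 3 → Fin 2) (s : Fin 3) :
    tensorFactor (tensorVec y) e s = (∏ t ∈ Finset.univ.erase s, y t (e t)) • y s := by
  funext i
  simp only [tensorFactor, tensorVec_update, Pi.smul_apply, smul_eq_mul, mul_comm]

/-- The slice of a pure tensor in direction `s` is a multiple of its `s`-th factor, with nonzero
multiplier when taken through a nonzero coordinate. -/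
theorem segre_injective : Function.Injective segre := by
  intro P Q h
  obtain ⟨c, hc⟩ := (Projectivization.mk_eq_mk_iff' _ _ _ _ _).1 h
  have hc' : c • tensorVec (fun s => (Q s).rep) = tensorVec fun s => (P s).rep := hc
  have he : ∀ s, ∃ i, (P s).rep i ≠ 0 := fun s => Function.ne_iff.1 (P s).rep_nonzero
  choose e he using he
  funext s
  have h1 := congrArg (fun z => tensorFactor z e s) hc'
  have h2 : tensorFactor (c • tensorVec fun s => (Q s).rep) e s =
      c • tensorFactor (tensorVec fun s => (Q s).rep) e s := rfl
  simp only [h2, tensorFactor_tensorVec, smul_smul] at h1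
  have h3 : ∏ t ∈ Finset.univ.erase s, (P t).rep (e t) ≠ 0 :=
    Finset.prod_ne_zero_iff.2 fun t _ => he t
  rw [← (P s).mk_rep, ← (Q s).mk_rep]
  refine (Projectivization.mk_eq_mk_iff' _ _ _ _ _).2
    ⟨(∏ t ∈ Finset.univ.erase s, (P t).rep (e t))⁻¹ *
      (c * ∏ t ∈ Finset.univ.erase s, (Q t).rep (e t)), ?_⟩
  rw [mul_smul, h1, smul_smul, inv_mul_cancel₀ h3, one_smul]

theorem segreMap_injective : Function.Injective segreMap := by
  intro p q h
  have h0 : p.1 = q.1 := congrArg (fun r : Space₂ => r.1) h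
  have h1 : p.2 none = q.2 none := congrArg (fun r : Space₂ => r.2 (some none)) h
  have h2 := segre_injective (congrArg (fun r : Space₂ => r.2 none) h)
  refine Prod.ext h0 (funext fun o => ?_)
  cases o with
  | none => exact h1
  | some s => exact congrFun h2 s

/-! ### The isomorphism of real varieties -/

/-- The variable of a homogeneous coordinate of `ℙ⁵` in `ℂ₀ × ℂ³ × ℙ⁵ × (ℙ¹)³`. -/
def dirVarT (x : SideCoord) : CoordRing AffCoord (adjoin (fun _ : Fin 3 => Fin 2) SideCoord) :=
  MvPolynomial.X (Sum.inr ⟨none, x⟩)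

/-- The variable of a homogeneous coordinate of the projective line of the side `s`. -/
def argVar (s : Fin 3) (i : Fin 2) :
    CoordRing AffCoord (adjoin (fun _ : Fin 3 => Fin 2) SideCoord) :=
  MvPolynomial.X (Sum.inr ⟨some s, i⟩)

theorem isMultiHom_dirVarT (x : SideCoord) : IsMultiHom (dirVarT x) (Pi.single none 1) :=
  isMultiHom_X_inr (ι := adjoin (fun _ : Fin 3 => Fin 2) SideCoord) (k := none) x

theorem isMultiHom_argVar (s : Fin 3) (i : Fin 2) :
    IsMultiHom (argVar s i) (Pi.single (some s) 1) :=
  isMultiHom_X_inr (ι := adjoin (fun _ : Fin 3 => Fin 2) SideCoord) (k := some s) i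

theorem valAt_dirVarT (x : SideCoord) (q : SpaceT) : valAt (dirVarT x) q = (q.2 none).rep x :=
  valAt_X _ _

theorem valAt_argVar (s : Fin 3) (i : Fin 2) (q : SpaceT) :
    valAt (argVar s i) q = (q.2 (some s)).rep i := valAt_X _ _

theorem exists_eq_mk_of_eq {J : Type} {P : ℙ ℝ (J → ℝ)} {v w : J → ℝ} (hw : w ≠ 0)
    (hP : P = Projectivization.mk ℝ w hw) (h : v = w) :
    ∃ hv : v ≠ 0, P = Projectivization.mk ℝ v hv := by
  subst h
  exact ⟨hw, hP⟩

theorem isRegularMapOn_segreMap (V : Set SpaceT) : IsRegularMapOn segreMap V := by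
  intro p _
  let Q : (k : Option (Option Empty)) → adjoin (adjoin noFactor SideCoord) (Fin 3 → Fin 2) k →
      CoordRing AffCoord (adjoin (fun _ : Fin 3 => Fin 2) SideCoord) := fun k => match k with
    | none => fun e => ∏ s, argVar s (e s)
    | some none => dirVarT
    | some (some k) => k.elim
  let d : Option (Option Empty) → Option (Fin 3) → ℕ := fun k => match k with
    | none => ∑ s, Pi.single (some s) 1
    | some none => Pi.single none 1
    | some (some k) => k.elim
  refine ⟨1, 0, fun a => MvPolynomial.X (Sum.inl a), Q, d,
    MvPolynomial.isWeightedHomogeneous_one ℝ _, by simp [valAt_one], fun a => isMultiHom_X_inl a,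
    fun k i => ?_, fun q _ _ => ⟨fun a => ?_, fun k => ?_⟩⟩
  · rcases k with _ | _ | k
    · exact isMultiHom_prod fun s _ => isMultiHom_argVar s _
    · exact isMultiHom_dirVarT i
    · exact k.elim
  · rw [valAt_one, valAt_X, div_one]
    rfl
  · rcases k with _ | _ | k
    · refine exists_eq_mk_of_eq (segre_ne_zero fun s => q.2 (some s)) rfl (funext fun e => ?_)
      exact (valAt_prod _ _ _).trans (Finset.prod_congr rfl fun s _ => valAt_argVar s _ q)
    · exact exists_eq_mk_of_eq (q.2 none).rep_nonzero (q.2 none).mk_rep.symm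
        (funext fun x => valAt_dirVarT x q)
    · exact k.elim

theorem eq_mk_tensorFactor {P : Fin 3 → ℙ ℝ (Fin 2 → ℝ)} {e : Fin 3 → Fin 2}
    (he : (segre P).rep e ≠ 0) (s : Fin 3) :
    P s = Projectivization.mk ℝ (tensorFactor (segre P).rep e s) (tensorFactor_ne_zero he s) := by
  obtain ⟨c, hc⟩ := Projectivization.exists_smul_eq_mk_rep ℝ _ (segre_ne_zero P)
  have h : (segre P).rep = (c : ℝ) • tensorVec fun s => (P s).rep := hc.symm
  have h1 : tensorFactor (segre P).rep e s =
      ((c : ℝ) * ∏ t ∈ Finset.univ.erase s, (P t).rep (e t)) • (P s).rep := by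
    rw [mul_smul, ← tensorFactor_tensorVec (fun s => (P s).rep), h]
    rfl
  refine Eq.trans (P s).mk_rep.symm (Eq.symm ?_)
  exact (Projectivization.mk_eq_mk_iff' _ _ _ _ _).2 ⟨_, h1.symm⟩

instance nonempty_spaceT : Nonempty SpaceT :=
  ⟨geomVarEquiv (0, 0, Projectivization.mk ℝ (fun _ => 1)
    (Function.ne_iff.2 ⟨(0, 0), one_ne_zero⟩), 0)⟩

/-- On the chart where coordinate `e` of `ℙ⁷` is nonzero, the slices through `e` give the three
factors by linear forms. -/
theorem isRegularMapOn_invFun_segreMap :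
    IsRegularMapOn (Function.invFun segreMap) blowup₂ := by
  intro p _
  obtain ⟨e, he⟩ := Function.ne_iff.1 (p.2 none).rep_nonzero
  let Q : (k : Option (Fin 3)) → adjoin (fun _ : Fin 3 => Fin 2) SideCoord k →
      CoordRing AffCoord (adjoin (adjoin noFactor SideCoord) (Fin 3 → Fin 2)) :=
    fun k => match k with
    | none => dirVar₂
    | some s => fun i => tensorVar (Function.update e s i)
  let d : Option (Fin 3) → Option (Option Empty) → ℕ := fun k => match k with
    | none => Pi.single (some none) 1
    | some s => Pi.single none 1
  -- The factor `tensorVar e` gives the affine coordinates the multidegree of the denominator that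
  -- marks the chart.
  refine ⟨tensorVar e, Pi.single none 1, fun a => MvPolynomial.X (Sum.inl a) * tensorVar e, Q, d,
    isMultiHom_tensorVar e, ?_, fun a => ?_, fun k i => ?_, fun q hq hS => ?_⟩
  · rw [valAt_tensorVar]
    exact he
  · simpa using (isMultiHom_X_inl a).mul (isMultiHom_tensorVar e)
  · cases k with
    | none => exact isMultiHom_dirVar₂ i
    | some s => exact isMultiHom_tensorVar _
  · rw [valAt_tensorVar] at hS
    rw [← segreMap_image_triangles] at hq
    obtain ⟨r, -, rfl⟩ := hq
    rw [Function.leftInverse_invFun segreMap_injective r]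
    refine ⟨fun a => ?_, fun k => ?_⟩
    · rw [valAt_mul, valAt_tensorVar, valAt_X, mul_div_cancel_right₀ _ hS]
      rfl
    · cases k with
      | none =>
        exact exists_eq_mk_of_eq (r.2 none).rep_nonzero (r.2 none).mk_rep.symm
          (funext fun x => valAt_dirVar₂ x _)
      | some s =>
        exact exists_eq_mk_of_eq _ (eq_mk_tensorFactor hS s) (funext fun i => valAt_tensorVar _ _)

theorem isBiregularOn_segreMap :
    IsBiregularOn segreMap (geomVarEquiv '' triangles) blowup₂ :=
  ⟨isRegularMapOn_segreMap _, segreMap_image_triangles, Function.invFun segreMap,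
    isRegularMapOn_invFun_segreMap, fun p _ => Function.leftInverse_invFun segreMap_injective p⟩

/-! ### Smoothness of the space of triangles -/

/-- The side coordinates, except those of the side `z` and the coordinate `m`. -/
abbrev FreeCoord (z : Fin 3) (m : SideCoord) : Type := {p : SideCoord // p.1 ≠ z ∧ p ≠ m}

theorem card_freeCoord {z : Fin 3} {m : SideCoord} (h : m.1 ≠ z) :
    Fintype.card (FreeCoord z m) = 3 := by
  revert z m
  decide

/-- Equations of `Incident` on the chart where the direction variable of `m` does not vanish. -/
def chartEqs {σ : Type} (V R : SideCoord → MvPolynomial σ ℝ) (z : Fin 3) (m : SideCoord) :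
    Fin 2 ⊕ Fin 2 ⊕ FreeCoord z m → MvPolynomial σ ℝ :=
  Sum.elim (fun i => ∑ s, V (s, i)) (Sum.elim (fun i => ∑ s, R (s, i))
    fun p => V p * R m - V m * R p)

theorem eval_chartEqs_eq_zero {σ : Type} {V R : SideCoord → MvPolynomial σ ℝ} {f : σ → ℝ}
    (h : Incident (fun x => MvPolynomial.eval f (V x)) (fun x => MvPolynomial.eval f (R x)))
    (z : Fin 3) (m : SideCoord) (j) : MvPolynomial.eval f (chartEqs V R z m j) = 0 := by
  rcases j with i | i | p
  · simpa [chartEqs] using h.sum_left i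
  · simpa [chartEqs] using h.sum_right i
  · simpa [chartEqs, sub_eq_zero] using h.parallel p m

/-- The omitted relations on side `z` follow from those on the other two sides and the two sums.
Dividing by the value of `R m` then exhibits `V` as a multiple of `R`. -/
theorem incident_of_chartEqs {σ : Type} {V R : SideCoord → MvPolynomial σ ℝ} {f : σ → ℝ}
    {z : Fin 3} {m : SideCoord} (hm : MvPolynomial.eval f (R m) ≠ 0)
    (h : ∀ j, MvPolynomial.eval f (chartEqs V R z m j) = 0) :
    Incident (fun x => MvPolynomial.eval f (V x)) (fun x => MvPolynomial.eval f (R x)) := by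
  have h1 : ∀ i, ∑ s, MvPolynomial.eval f (V (s, i)) = 0 := fun i => by
    simpa [chartEqs] using h (Sum.inl i)
  have h2 : ∀ i, ∑ s, MvPolynomial.eval f (R (s, i)) = 0 := fun i => by
    simpa [chartEqs] using h (Sum.inr (Sum.inl i))
  have h3 : ∀ p : SideCoord, p.1 ≠ z → MvPolynomial.eval f (V p) * MvPolynomial.eval f (R m) =
      MvPolynomial.eval f (V m) * MvPolynomial.eval f (R p) := by
    intro p hp
    by_cases hpm : p = m
    · rw [hpm]
    · simpa [chartEqs, sub_eq_zero] using h (Sum.inr (Sum.inr ⟨p, hp, hpm⟩))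
  have h4 : ∀ p : SideCoord, MvPolynomial.eval f (V p) * MvPolynomial.eval f (R m) =
      MvPolynomial.eval f (V m) * MvPolynomial.eval f (R p) := by
    rintro ⟨s, i⟩
    by_cases hs : s = z
    · subst hs
      have e1 := h1 i
      have e2 := h2 i
      have e3 := h3 (s + 1, i) (by simp)
      have e4 := h3 (s + 2, i) (by simp)
      rw [sum_fin_three_eq s] at e1 e2
      linear_combination MvPolynomial.eval f (R m) * e1 - MvPolynomial.eval f (V m) * e2 - e3 - e4
    · exact h3 _ hs
  have h5 := incident_smul_left (x := fun x => MvPolynomial.eval f (R x)) h2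
    (MvPolynomial.eval f (V m) / MvPolynomial.eval f (R m))
  convert h5 using 1
  funext p
  simp only [Pi.smul_apply, smul_eq_mul]
  field_simp
  exact h4 p

/-- The side derivatives of the chart equations are independent modulo the directions. -/
theorem eq_zero_of_side_derivatives {x : SideCoord → ℝ} {z : Fin 3} {m : SideCoord}
    (hm : x m ≠ 0) (hz : m.1 ≠ z) {α : Fin 2 → ℝ} {γ : FreeCoord z m → ℝ}
    (h : ∀ y : SideCoord, ∑ k, α k * (if k = y.2 then 1 else 0) +
      ∑ p, γ p * ((if p.1 = y then 1 else 0) * x m - (if m = y then 1 else 0) * x p) = 0) :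
    (∀ k, α k = 0) ∧ ∀ p, γ p = 0 := by
  -- No minor of the chart involves a side variable of `z`, so differentiating by one isolates `α`.
  have hα : ∀ k, α k = 0 := by
    intro k
    have h1 := h (z, k)
    rw [Finset.sum_eq_zero (s := (Finset.univ : Finset (FreeCoord z m)))] at h1
    · simpa using h1
    · intro p _
      rw [if_neg (fun h => p.2.1 (by rw [h])), if_neg (fun h => hz (by rw [h]))]
      simp
  refine ⟨hα, fun p => ?_⟩
  have h1 := h p
  rw [Finset.sum_eq_single_of_mem p (Finset.mem_univ p)] at h1
  · rw [if_pos rfl, if_neg p.2.2.symm] at h1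
    simpa [hα, hm] using h1
  · intro q _ hq
    rw [if_neg (fun h => hq (Subtype.ext h)), if_neg p.2.2.symm]
    simp

/-! ### Partial derivatives of the coordinate variables. -/

section derivatives

open MvPolynomial

variable {κ : Type} {ι : κ → Type}

theorem pderiv_X_ite {σ : Type} [DecidableEq σ] (i j : σ) :
    pderiv i (X j : MvPolynomial σ ℝ) = if j = i then 1 else 0 := by
  rw [pderiv_X, Pi.single_apply]

theorem pderiv_inl_sideVar (x y : SideCoord) :
    pderiv (Sum.inl (some y.1, y.2)) (sideVar ι x) = if x = y then 1 else 0 := by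
  classical
  rw [sideVar, pderiv_X_ite]
  congr 1
  simp [Prod.ext_iff]

theorem pderiv_inl_X_inr (c : AffCoord) (x : Σ k, ι k) :
    pderiv (Sum.inl c) (X (Sum.inr x) : CoordRing AffCoord ι) = 0 :=
  pderiv_X_of_ne (by simp)

theorem pderiv_inr_sideVar (x : SideCoord) (y : Σ k, ι k) :
    pderiv (Sum.inr y) (sideVar ι x) = 0 :=
  pderiv_X_of_ne (by simp)

theorem valAt_ite_one_zero (P : Prop) [Decidable P] (p : MultiProj AffCoord ι) :
    valAt (if P then 1 else 0 : CoordRing AffCoord ι) p = if P then 1 else 0 := by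
  split_ifs
  · exact valAt_one p
  · exact valAt_zero p

theorem sum_ite_side_eq {M : Type} [AddCommMonoid M] [One M] (k : Fin 2) (y : SideCoord) :
    ∑ s, (if (s, k) = y then (1 : M) else 0) = if k = y.2 then 1 else 0 := by
  obtain ⟨t, l⟩ := y
  by_cases h : k = l <;> simp [h]

end derivatives

/-- The equations of the space of triangles. -/
def triangleEqs {J : Type}
    (f : J → CoordRing AffCoord (adjoin (fun _ : Fin 3 => Fin 2) SideCoord)) :
    J ⊕ Fin 3 → CoordRing AffCoord (adjoin (fun _ : Fin 3 => Fin 2) SideCoord) :=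
  Sum.elim f fun s => dirVarT (s, 0) * argVar s 1 - dirVarT (s, 1) * argVar s 0

theorem isMultiHom_triangleEqs {J : Type}
    {f : J → CoordRing AffCoord (adjoin (fun _ : Fin 3 => Fin 2) SideCoord)}
    (hf : ∀ j, ∃ d, IsMultiHom (f j) d) (j : J ⊕ Fin 3) :
    ∃ d, IsMultiHom (triangleEqs f j) d := by
  rcases j with j | s
  · exact hf j
  · exact ⟨_, ((isMultiHom_dirVarT _).mul (isMultiHom_argVar s _)).sub
      ((isMultiHom_dirVarT _).mul (isMultiHom_argVar s _))⟩

theorem isMultiHom_chartEqs {κ : Type} {ι : κ → Type} {R : SideCoord → CoordRing AffCoord ι}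
    {w : κ → ℕ} (hR : ∀ x, IsMultiHom (R x) w) (z : Fin 3) (m : SideCoord) (j) :
    ∃ d, IsMultiHom (chartEqs (sideVar ι) R z m j) d := by
  rcases j with i | i | x
  · exact ⟨0, show IsMultiHom (∑ s, sideVar ι (s, i)) 0 from
      isMultiHom_sum fun s _ => isMultiHom_sideVar ι _⟩
  · exact ⟨w, show IsMultiHom (∑ s, R (s, i)) w from isMultiHom_sum fun s _ => hR _⟩
  · exact ⟨0 + w, ((isMultiHom_sideVar ι _).mul (hR _)).sub ((isMultiHom_sideVar ι _).mul (hR _))⟩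

theorem triangleEqs_iff {J : Type}
    {f : J → CoordRing AffCoord (adjoin (fun _ : Fin 3 => Fin 2) SideCoord)} (q : SpaceT) :
    (∀ j, valAt (triangleEqs f j) q = 0) ↔ (∀ j, valAt (f j) q = 0) ∧
      ∀ s, IsParallel (fun i => (q.2 none).rep (s, i)) (q.2 (some s)).rep := by
  refine Sum.forall.trans (and_congr Iff.rfl (forall_congr' fun s => ?_))
  simp only [triangleEqs, Sum.elim_inr, valAt_sub, valAt_mul, valAt_dirVarT, valAt_argVar,
    sub_eq_zero, IsParallel]

theorem eval_sideVar_dirVarT (q : SpaceT) :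
    Incident (fun x => MvPolynomial.eval (coordVec q) (sideVar _ x))
      (fun x => MvPolynomial.eval (coordVec q) (dirVarT x)) ↔
    Incident (sidePart q.1) (q.2 none).rep := by
  simp only [← valAt.eq_def, valAt_sideVar, valAt_dirVarT]

theorem isAlgebraicSet_triangles : IsAlgebraicSet (geomVarEquiv '' triangles) := by
  have h : geomVarEquiv '' triangles =
      {q | ∀ j, valAt (triangleEqs (incidenceEqs (sideVar _) dirVarT) j) q = 0} := by
    ext q
    rw [mem_triangles_image_iff, Set.mem_ofPred_eq, triangleEqs_iff]
    refine and_congr_left fun _ => ?_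
    rw [← eval_sideVar_dirVarT]
    exact (eval_incidenceEqs_eq_zero_iff _ _ _).symm
  rw [h]
  exact isAlgebraicSet_commonZeros _
    (isMultiHom_triangleEqs (isMultiHom_incidenceEqs isMultiHom_dirVarT))

theorem ambientDim_spaceT :
    ambientDim AffCoord (adjoin (fun _ : Fin 3 => Fin 2) SideCoord) = 16 := by
  rw [ambientDim, Fintype.sum_option]
  simp [adjoin, Nat.card_eq_fintype_card]

/-- The chart has `2 + 2 + 3 + 3` equations. In a linear relation between their gradients, the side
derivatives kill the coefficients of the side sums and of the minors. The argument derivatives give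
`g t * x (t, i) = 0` for the parallelism coefficients `g t`, which vanishes for the side of `m`. The
direction derivatives on that side then kill the coefficients of the direction sums, and on the
other sides they kill the remaining `g t`, since the argument coordinates are not both zero. -/
theorem isSmoothVariety_triangles : IsSmoothVariety (geomVarEquiv '' triangles) 6 := by
  refine isSmoothVariety_of_equations isAlgebraicSet_triangles fun p hp => ?_
  obtain ⟨hinc, hpar⟩ := (mem_triangles_image_iff p).1 hp
  obtain ⟨m, hm⟩ := Function.ne_iff.1 (p.2 none).rep_nonzero
  replace hm : (p.2 none).rep m ≠ 0 := hm
  have hz : m.1 ≠ m.1 + 1 := by simp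
  refine ⟨_, inferInstance, triangleEqs (chartEqs (sideVar _) dirVarT (m.1 + 1) m), dirVarT m, ?_,
    isMultiHom_triangleEqs (isMultiHom_chartEqs isMultiHom_dirVarT _ m), fun j q hq => ?_,
    ⟨_, isMultiHom_dirVarT m⟩, ?_, fun q hq h => ?_, ?_⟩
  · rw [ambientDim_spaceT]
    simp only [Fintype.card_sum, card_freeCoord hz, Fintype.card_fin]
  · obtain ⟨h1, h2⟩ := (mem_triangles_image_iff q).1 hq
    revert j
    rw [triangleEqs_iff]
    exact ⟨eval_chartEqs_eq_zero ((eval_sideVar_dirVarT q).2 h1) _ m, h2⟩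
  · rwa [valAt_dirVarT]
  · rw [triangleEqs_iff] at h
    exact (mem_triangles_image_iff q).2
      ⟨(eval_sideVar_dirVarT q).1 (incident_of_chartEqs hq h.1), h.2⟩
  · rw [Fintype.linearIndependent_iff]
    intro g hg
    have hg' : ∀ x, ∑ j, g j * valAt (MvPolynomial.pderiv x
        (triangleEqs (chartEqs (sideVar _) dirVarT (m.1 + 1) m) j)) p = 0 := by
      intro x
      simpa using congrFun hg x
    simp only [Fintype.sum_sum_type, triangleEqs, chartEqs, Sum.elim_inl, Sum.elim_inr, map_sum,
      map_sub, Derivation.leibniz, smul_eq_mul] at hg'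
    have dVR : ∀ x y : SideCoord, MvPolynomial.pderiv (Sum.inl (some y.1, y.2)) (dirVarT x) = 0 :=
      fun x y => pderiv_inl_X_inr _ _
    have dVA : ∀ s i (y : SideCoord),
        MvPolynomial.pderiv (Sum.inl (some y.1, y.2)) (argVar s i) = 0 :=
      fun s i y => pderiv_inl_X_inr _ _
    have dRV : ∀ x y : SideCoord, MvPolynomial.pderiv (Sum.inr ⟨none, y⟩)
        (sideVar (adjoin (fun _ : Fin 3 => Fin 2) SideCoord) x) = 0 :=
      fun x y => pderiv_inr_sideVar _ _
    have dRR : ∀ x y : SideCoord, MvPolynomial.pderiv (Sum.inr ⟨none, y⟩) (dirVarT x) =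
        if x = y then 1 else 0 := fun x y => by
      classical
      rw [dirVarT, pderiv_X_ite]
      simp
    have dRA : ∀ s i (y : SideCoord), MvPolynomial.pderiv (Sum.inr ⟨none, y⟩) (argVar s i) = 0 :=
      fun s i y => MvPolynomial.pderiv_X_of_ne (by simp)
    have dAV : ∀ (x : SideCoord) t (l : Fin 2), MvPolynomial.pderiv (Sum.inr ⟨some t, l⟩)
        (sideVar (adjoin (fun _ : Fin 3 => Fin 2) SideCoord) x) = 0 :=
      fun x t l => pderiv_inr_sideVar _ _
    have dAR : ∀ (x : SideCoord) t (l : Fin 2),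
        MvPolynomial.pderiv (Sum.inr ⟨some t, l⟩) (dirVarT x) = 0 :=
      fun x t l => MvPolynomial.pderiv_X_of_ne (by simp)
    have dAA : ∀ s i t (l : Fin 2), MvPolynomial.pderiv (Sum.inr ⟨some t, l⟩) (argVar s i) =
        if s = t ∧ i = l then 1 else 0 := fun s i t l => by
      classical
      rw [argVar, pderiv_X_ite]
      congr 1
      simp only [Sum.inr.injEq, eq_iff_iff]
      constructor
      · intro h
        cases h
        exact ⟨rfl, rfl⟩
      · rintro ⟨rfl, rfl⟩
        rfl
    have hV := fun y : SideCoord => hg' (Sum.inl (some y.1, y.2))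
    simp only [pderiv_inl_sideVar, dVR, dVA, sum_ite_side_eq, mul_zero, add_zero, zero_add,
      sub_zero, Finset.sum_const_zero, valAt_zero, valAt_sub, valAt_mul, valAt_ite_one_zero,
      valAt_dirVarT] at hV
    obtain ⟨hα, hγ⟩ := eq_zero_of_side_derivatives hm hz
      (α := fun k => g (Sum.inl (Sum.inl k))) (γ := fun x => g (Sum.inl (Sum.inr (Sum.inr x))))
      (fun y => by simpa only [mul_comm] using hV y)
    have hR := fun y : SideCoord => hg' (Sum.inr ⟨none, y⟩)
    have hA := fun t (l : Fin 2) => hg' (Sum.inr ⟨some t, l⟩)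
    simp only [hα, hγ, dRV, dRR, dRA, sum_ite_side_eq, mul_zero, zero_mul, add_zero, zero_add,
      Finset.sum_const_zero, valAt_sub, valAt_mul, valAt_ite_one_zero, valAt_argVar] at hR
    simp only [hα, hγ, dAV, dAR, dAA, mul_zero, zero_mul, add_zero, zero_add,
      Finset.sum_const_zero, valAt_zero, valAt_sub, valAt_mul, valAt_ite_one_zero,
      valAt_dirVarT] at hA
    have hA0 : ∀ t i, g (Sum.inr t) * (p.2 none).rep (t, i) = 0 := by
      intro t i
      fin_cases i
      · simpa using hA t 1
      · simpa using hA t 0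
    have hδm : g (Sum.inr m.1) = 0 := (mul_eq_zero.1 (hA0 m.1 m.2)).resolve_right hm
    have hR0 : ∀ t, g (Sum.inl (Sum.inr (Sum.inl 0))) +
        g (Sum.inr t) * (p.2 (some t)).rep 1 = 0 := by
      intro t
      simpa using hR (t, 0)
    have hR1 : ∀ t, g (Sum.inl (Sum.inr (Sum.inl 1))) -
        g (Sum.inr t) * (p.2 (some t)).rep 0 = 0 := by
      intro t
      simpa [sub_eq_add_neg] using hR (t, 1)
    have hβ0 : g (Sum.inl (Sum.inr (Sum.inl 0))) = 0 := by simpa [hδm] using hR0 m.1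
    have hβ1 : g (Sum.inl (Sum.inr (Sum.inl 1))) = 0 := by simpa [hδm] using hR1 m.1
    rintro ((k | k | x) | t)
    · exact hα k
    · fin_cases k
      · exact hβ0
      · exact hβ1
    · exact hγ x
    · obtain ⟨i, hi⟩ := Function.ne_iff.1 (p.2 (some t)).rep_nonzero
      fin_cases i
      · have := hR1 t
        rw [hβ1, zero_sub, neg_eq_zero] at this
        exact (mul_eq_zero.1 this).resolve_right hi
      · have := hR0 t
        rw [hβ0, zero_add] at this
        exact (mul_eq_zero.1 this).resolve_right hi

/-! ### Smoothness of the second blowup -/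

/-- The indices which differ from `e` in at least two places. -/
abbrev FarIndex (e : Fin 3 → Fin 2) : Type :=
  {f : Fin 3 → Fin 2 // ∀ s, Function.update e s (f s) ≠ f}

/-- Of the eight indices, `e` and its three neighbours are excluded. -/
theorem card_farIndex (e : Fin 3 → Fin 2) : Fintype.card (FarIndex e) = 4 := by
  revert e
  decide

/-- Equations of the second blowup on the chart where the `e`-th coordinate of `ℙ⁷` does not
vanish. -/
def blowupChartEqs {J : Type}
    (f : J → CoordRing AffCoord (adjoin (adjoin noFactor SideCoord) (Fin 3 → Fin 2)))
    (e : Fin 3 → Fin 2) : J ⊕ Fin 3 ⊕ FarIndex e →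
      CoordRing AffCoord (adjoin (adjoin noFactor SideCoord) (Fin 3 → Fin 2)) :=
  Sum.elim f (Sum.elim
    (fun s => dirVar₂ (s, e s) * tensorVar (Function.update e s (e s + 1)) -
      dirVar₂ (s, e s + 1) * tensorVar e)
    (fun h => tensorVar h * (tensorVar e * tensorVar e) -
      tensorVar (Function.update e 0 (h.1 0)) *
        (tensorVar (Function.update e 1 (h.1 1)) * tensorVar (Function.update e 2 (h.1 2)))))

theorem isMultiHom_blowupChartEqs {J : Type}
    {f : J → CoordRing AffCoord (adjoin (adjoin noFactor SideCoord) (Fin 3 → Fin 2))}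
    (hf : ∀ j, ∃ d, IsMultiHom (f j) d) (e : Fin 3 → Fin 2) (j) :
    ∃ d, IsMultiHom (blowupChartEqs f e j) d := by
  rcases j with j | s | h
  · exact hf j
  · exact ⟨_, ((isMultiHom_dirVar₂ _).mul (isMultiHom_tensorVar _)).sub
      ((isMultiHom_dirVar₂ _).mul (isMultiHom_tensorVar _))⟩
  · exact ⟨_, ((isMultiHom_tensorVar _).mul ((isMultiHom_tensorVar _).mul
      (isMultiHom_tensorVar _))).sub ((isMultiHom_tensorVar _).mul
        ((isMultiHom_tensorVar _).mul (isMultiHom_tensorVar _)))⟩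

theorem isParallel_tensorFactor_iff (x : SideCoord → ℝ) (z : (Fin 3 → Fin 2) → ℝ)
    (e : Fin 3 → Fin 2) (s : Fin 3) :
    IsParallel (fun i => x (s, i)) (tensorFactor z e s) ↔
      x (s, e s) * z (Function.update e s (e s + 1)) = x (s, e s + 1) * z e := by
  have h2 : z e = z (Function.update e s (e s)) := by rw [Function.update_eq_self]
  rw [h2]
  simp only [IsParallel, tensorFactor]
  generalize e s = i
  fin_cases i
  · exact Iff.rfl
  · exact eq_comm

theorem IsCompatible.chart {x : SideCoord → ℝ} {z : (Fin 3 → Fin 2) → ℝ}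
    (h : IsCompatible x z) (e : Fin 3 → Fin 2) :
    (∀ s, x (s, e s) * z (Function.update e s (e s + 1)) = x (s, e s + 1) * z e) ∧
      ∀ h : FarIndex e, z h * (z e * z e) = z (Function.update e 0 (h.1 0)) *
        (z (Function.update e 1 (h.1 1)) * z (Function.update e 2 (h.1 2))) := by
  refine ⟨fun s => (isParallel_tensorFactor_iff x z e s).1 (h.isParallel_tensorFactor e s),
    fun f => ?_⟩
  have := congrFun (h.tensorVec_tensorFactor e) f
  simp only [tensorVec, tensorFactor, Pi.smul_apply, smul_eq_mul, Fin.prod_univ_three] at this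
  linear_combination -this

/-- The cubic relation `z f * z e ^ 2 = ` (product of slices) is trivial when `f` differs from `e`
in at most one place, so the four far indices already make `z` a pure tensor. -/
theorem isCompatible_iff_chart {x : SideCoord → ℝ} {z : (Fin 3 → Fin 2) → ℝ}
    {e : Fin 3 → Fin 2} (he : z e ≠ 0) :
    IsCompatible x z ↔
      (∀ s, x (s, e s) * z (Function.update e s (e s + 1)) = x (s, e s + 1) * z e) ∧
      ∀ h : FarIndex e, z h * (z e * z e) = z (Function.update e 0 (h.1 0)) *
        (z (Function.update e 1 (h.1 1)) * z (Function.update e 2 (h.1 2))) := by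
  refine ⟨fun h => h.chart e, fun ⟨h1, h2⟩ => ?_⟩
  have ht : tensorVec (tensorFactor z e) = z e ^ 2 • z := by
    funext f
    simp only [tensorVec, tensorFactor, Pi.smul_apply, smul_eq_mul]
    by_cases hf : ∀ s, Function.update e s (f s) ≠ f
    · rw [Fin.prod_univ_three]
      linear_combination -h2 ⟨f, hf⟩
    · push Not at hf
      obtain ⟨s, hs⟩ := hf
      have hne : ∀ t, t ≠ s → Function.update e t (f t) = e := by
        intro t ht
        rw [← hs, Function.update_of_ne ht, Function.update_eq_self]
      have h12 : s + 1 ≠ s ∧ s + 2 ≠ s := by simp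
      rw [prod_fin_three_eq s, hs, hne _ h12.1, hne _ h12.2]
      ring
  have hz : z = (z e ^ 2)⁻¹ • tensorVec (tensorFactor z e) := by
    rw [ht, smul_smul, inv_mul_cancel₀ (pow_ne_zero 2 he), one_smul]
  rw [hz]
  exact (isCompatible_tensorVec fun s =>
    (isParallel_tensorFactor_iff x z e s).2 (h1 s)).smul_right _

theorem blowupChartEqs_iff {J : Type}
    {f : J → CoordRing AffCoord (adjoin (adjoin noFactor SideCoord) (Fin 3 → Fin 2))}
    {e : Fin 3 → Fin 2} {q : Space₂} :
    (∀ j, valAt (blowupChartEqs f e j) q = 0) ↔ (∀ j, valAt (f j) q = 0) ∧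
      (∀ s, (q.2 (some none)).rep (s, e s) *
        (q.2 none).rep (Function.update e s (e s + 1)) =
          (q.2 (some none)).rep (s, e s + 1) * (q.2 none).rep e) ∧
      ∀ h : FarIndex e, (q.2 none).rep h * ((q.2 none).rep e * (q.2 none).rep e) =
        (q.2 none).rep (Function.update e 0 (h.1 0)) *
          ((q.2 none).rep (Function.update e 1 (h.1 1)) *
            (q.2 none).rep (Function.update e 2 (h.1 2))) := by
  refine Sum.forall.trans (and_congr Iff.rfl (Sum.forall.trans (and_congr ?_ ?_)))
  · refine forall_congr' fun s => ?_
    simp only [blowupChartEqs, Sum.elim_inr, Sum.elim_inl, valAt_sub, valAt_mul, valAt_dirVar₂,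
      valAt_tensorVar, sub_eq_zero]
  · refine forall_congr' fun s => ?_
    simp only [blowupChartEqs, Sum.elim_inr, valAt_sub, valAt_mul, valAt_tensorVar, sub_eq_zero]

theorem eval_sideVar_dirVar₂ (q : Space₂) :
    Incident (fun x => MvPolynomial.eval (coordVec q) (sideVar _ x))
      (fun x => MvPolynomial.eval (coordVec q) (dirVar₂ x)) ↔
    Incident (sidePart q.1) (q.2 (some none)).rep := by
  simp only [← valAt.eq_def, valAt_sideVar, valAt_dirVar₂]

theorem ambientDim_space₂ :
    ambientDim AffCoord (adjoin (adjoin noFactor SideCoord) (Fin 3 → Fin 2)) = 20 := by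
  rw [ambientDim, Fintype.sum_option, Fintype.sum_option]
  simp [adjoin, Nat.card_eq_fintype_card]

theorem update_add_one_eq_iff (e : Fin 3 → Fin 2) (s t : Fin 3) :
    Function.update e s (e s + 1) = Function.update e t (e t + 1) ↔ s = t := by
  refine ⟨fun h => ?_, fun h => by rw [h]⟩
  by_contra hst
  have h1 := congrFun h s
  rw [Function.update_self, Function.update_of_ne hst] at h1
  simp at h1

/-- This adapts the chart of `ℙ⁵` to that of `ℙ⁷`: with pivot `(u, e u)`, one parallelism equation
has a nonzero derivative in a `ℙ⁷` coordinate, where the elimination of the Jacobian can start. -/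
theorem exists_rep_ne_zero_of_isCompatible {x : SideCoord → ℝ} {z : (Fin 3 → Fin 2) → ℝ}
    (h : IsCompatible x z) (hx : x ≠ 0) {e : Fin 3 → Fin 2} (he : z e ≠ 0) :
    ∃ s, x (s, e s) ≠ 0 := by
  by_contra! h0
  refine hx (funext fun ⟨s, i⟩ => ?_)
  have h1 := (h.chart e).1 s
  rw [h0 s, zero_mul] at h1
  have h2 : x (s, e s + 1) = 0 := (mul_eq_zero.1 h1.symm).resolve_right he
  have h3 : i = e s ∨ i = e s + 1 := by
    generalize e s = j
    clear * -
    revert i j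
    decide
  rcases h3 with rfl | rfl
  · exact h0 s
  · exact h2

/-- The chart has `2 + 2 + 3 + 3 + 4` equations. The side variables are eliminated as for triangles;
the coefficients of the other equations vanish in the order `hε`, `hδu`, `hβ`, `hδ`. -/
theorem isSmoothVariety_blowup₂ : IsSmoothVariety blowup₂ 6 := by
  refine isSmoothVariety_of_equations (isAlgebraicSet_zariskiClosure _) fun p hp => ?_
  obtain ⟨hinc, hcomp⟩ := (mem_blowup₂_iff p).1 hp
  obtain ⟨e, he⟩ := Function.ne_iff.1 (p.2 none).rep_nonzero
  replace he : (p.2 none).rep e ≠ 0 := he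
  obtain ⟨u, hu⟩ := exists_rep_ne_zero_of_isCompatible hcomp (p.2 (some none)).rep_nonzero he
  have hz : ((u, e u) : SideCoord).1 ≠ u + 1 := by simp
  refine ⟨_, inferInstance, blowupChartEqs (chartEqs (sideVar _) dirVar₂ (u + 1) (u, e u)) e,
    dirVar₂ (u, e u) * tensorVar e, ?_,
    isMultiHom_blowupChartEqs (isMultiHom_chartEqs isMultiHom_dirVar₂ _ _) e, fun j q hq => ?_,
    ⟨_, (isMultiHom_dirVar₂ _).mul (isMultiHom_tensorVar _)⟩, ?_, fun q hq h => ?_, ?_⟩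
  · rw [ambientDim_space₂]
    simp only [Fintype.card_sum, card_freeCoord hz, card_farIndex, Fintype.card_fin]
  · obtain ⟨h1, h2⟩ := (mem_blowup₂_iff q).1 hq
    exact blowupChartEqs_iff.2
      ⟨eval_chartEqs_eq_zero ((eval_sideVar_dirVar₂ q).2 h1) _ _, h2.chart e⟩ j
  · rw [valAt_mul, valAt_dirVar₂, valAt_tensorVar]
    exact mul_ne_zero hu he
  · rw [valAt_mul, mul_ne_zero_iff, valAt_tensorVar] at hq
    rw [blowupChartEqs_iff, ← isCompatible_iff_chart hq.2] at h
    exact (mem_blowup₂_iff q).2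
      ⟨(eval_sideVar_dirVar₂ q).1 (incident_of_chartEqs hq.1 h.1), h.2⟩
  · rw [Fintype.linearIndependent_iff]
    intro g hg
    have hg' : ∀ x, ∑ j, g j * valAt (MvPolynomial.pderiv x
        (blowupChartEqs (chartEqs (sideVar _) dirVar₂ (u + 1) (u, e u)) e j)) p = 0 := by
      intro x
      simpa using congrFun hg x
    simp only [Fintype.sum_sum_type, blowupChartEqs, chartEqs, Sum.elim_inl, Sum.elim_inr, map_sum,
      map_sub, Derivation.leibniz, smul_eq_mul] at hg'
    have dVR : ∀ x y : SideCoord, MvPolynomial.pderiv (Sum.inl (some y.1, y.2)) (dirVar₂ x) = 0 :=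
      fun x y => pderiv_inl_X_inr _ _
    have dVZ : ∀ f (y : SideCoord),
        MvPolynomial.pderiv (Sum.inl (some y.1, y.2)) (tensorVar f) = 0 :=
      fun f y => pderiv_inl_X_inr _ _
    have dRV : ∀ x y : SideCoord, MvPolynomial.pderiv (Sum.inr ⟨some none, y⟩)
        (sideVar (adjoin (adjoin noFactor SideCoord) (Fin 3 → Fin 2)) x) = 0 :=
      fun x y => pderiv_inr_sideVar _ _
    have dRR : ∀ x y : SideCoord, MvPolynomial.pderiv (Sum.inr ⟨some none, y⟩) (dirVar₂ x) =
        if x = y then 1 else 0 := fun x y => by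
      classical
      rw [dirVar₂, pderiv_X_ite]
      simp
    have dRZ : ∀ f (y : SideCoord), MvPolynomial.pderiv (Sum.inr ⟨some none, y⟩)
        (tensorVar f) = 0 :=
      fun f y => MvPolynomial.pderiv_X_of_ne (by simp)
    have dZV : ∀ (x : SideCoord) (f : Fin 3 → Fin 2), MvPolynomial.pderiv (Sum.inr ⟨none, f⟩)
        (sideVar (adjoin (adjoin noFactor SideCoord) (Fin 3 → Fin 2)) x) = 0 :=
      fun x f => pderiv_inr_sideVar _ _
    have dZR : ∀ (x : SideCoord) (f : Fin 3 → Fin 2),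
        MvPolynomial.pderiv (Sum.inr ⟨none, f⟩) (dirVar₂ x) = 0 :=
      fun x f => MvPolynomial.pderiv_X_of_ne (by simp)
    have dZZ : ∀ f h : Fin 3 → Fin 2, MvPolynomial.pderiv (Sum.inr ⟨none, h⟩) (tensorVar f) =
        if f = h then 1 else 0 := fun f h => by
      classical
      rw [tensorVar, pderiv_X_ite]
      simp
    have hV := fun y : SideCoord => hg' (Sum.inl (some y.1, y.2))
    simp only [pderiv_inl_sideVar, dVR, dVZ, sum_ite_side_eq, mul_zero, add_zero, zero_add,
      sub_zero, Finset.sum_const_zero, valAt_zero, valAt_sub, valAt_mul, valAt_ite_one_zero,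
      valAt_dirVar₂] at hV
    obtain ⟨hα, hγ⟩ := eq_zero_of_side_derivatives hu hz
      (α := fun k => g (Sum.inl (Sum.inl k))) (γ := fun x => g (Sum.inl (Sum.inr (Sum.inr x))))
      (fun y => by simpa only [mul_comm] using hV y)
    have hR := fun y : SideCoord => hg' (Sum.inr ⟨some none, y⟩)
    have hZ := fun f : Fin 3 → Fin 2 => hg' (Sum.inr ⟨none, f⟩)
    simp only [hα, hγ, dRV, dRR, dRZ, sum_ite_side_eq, mul_zero, zero_mul, add_zero, zero_add,
      sub_zero, Finset.sum_const_zero, valAt_zero, valAt_sub, valAt_mul, valAt_ite_one_zero,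
      valAt_tensorVar] at hR
    simp only [hα, hγ, dZV, dZR, dZZ, mul_zero, add_zero, zero_add, sub_zero,
      Finset.sum_const_zero, valAt_zero, valAt_add, valAt_sub, valAt_mul, valAt_ite_one_zero,
      valAt_dirVar₂, valAt_tensorVar] at hZ
    -- A far coordinate occurs only in its own cubic, with coefficient the square of coordinate `e`.
    have hε : ∀ h : FarIndex e, g (Sum.inr (Sum.inr h)) = 0 := by
      intro h
      have hne : ∀ s i, Function.update e s i ≠ h := by
        intro s i hs
        apply h.2 s
        rw [← hs, Function.update_self]
      have hne' : e ≠ h := by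
        have := hne 0 (e 0)
        rwa [Function.update_eq_self] at this
      have h1 := hZ h
      simp only [hne, hne', if_false, mul_zero, sub_zero, add_zero, zero_add,
        Finset.sum_const_zero, ← Subtype.ext_iff] at h1
      simpa [he] using h1
    -- With the cubics gone, the neighbour of `e` at place `u` occurs only in the parallelism
    -- equation of `u`, with the pivot as coefficient.
    have hδu : g (Sum.inr (Sum.inl u)) = 0 := by
      have h1 := hZ (Function.update e u (e u + 1))
      have hne : e ≠ Function.update e u (e u + 1) := by
        intro h
        have := congrFun h u
        simp at this
      simp only [hε, hne, update_add_one_eq_iff, if_false, mul_zero, zero_mul, sub_zero, add_zero,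
        Finset.sum_const_zero] at h1
      simpa [hu] using h1
    have hβ : ∀ k, g (Sum.inl (Sum.inr (Sum.inl k))) = 0 := by
      intro k
      have h1 := hR (u, k)
      rw [Finset.sum_eq_zero (s := (Finset.univ : Finset (Fin 3)))] at h1
      · simpa using h1
      · intro s _
        by_cases hs : s = u
        · simp [hs, hδu]
        · simp [hs]
    -- The direction variable `(s, e s + 1)` has the nonzero coordinate `e` of `ℙ⁷`, up to sign, as
    -- its coefficient in the equation of `s`.
    have hδ : ∀ s, g (Sum.inr (Sum.inl s)) = 0 := by
      intro s
      have h1 := hR (s, e s + 1)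
      rw [Finset.sum_eq_single_of_mem s (Finset.mem_univ s)] at h1
      · simpa [hβ, he] using h1
      · intro t _ ht
        simp [ht]
    rintro ((k | k | x) | s | h)
    · exact hα k
    · exact hβ k
    · exact hγ x
    · exact hδ s
    · exact hε h

end

theorem theorem4p1 :
    IsBlowup baseSpace originLocus originEqs 0 blowup₁ ∧
    IsBlowup blowup₁ doubleStrict doubleEqs (fun _ => 3) blowup₂ ∧
    Function.Injective segreMap ∧
    segreMap '' (geomVarEquiv '' triangles) = blowup₂ ∧
    IsBiregularOn segreMap (geomVarEquiv '' triangles) blowup₂ ∧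
    IsSmoothVariety blowup₂ 6 ∧
    IsSmoothVariety (geomVarEquiv '' triangles) 6 :=
  ⟨isBlowup_blowup₁,
    ⟨isAlgebraicSet_zariskiClosure _, isAlgebraicSet_zariskiClosure _,
      fun q hq => ((mem_doubleStrict_iff q).1 hq).1, generatesIdealOf_doubleEqs, rfl⟩,
    segreMap_injective, segreMap_image_triangles, isBiregularOn_segreMap,
    isSmoothVariety_blowup₂, isSmoothVariety_triangles⟩
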